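/- Let $p$ be a prime number, let $k_0$ be a field of characteristic $p$ and let $S$ be a normal integral scheme which is projective over $k_0$. Write $F_S:S\to S$ for the absolute Frobenius endomorphism of $S$, $F_S^{n,*}$ for the pull-back along its $n$-th iterate, and $\Omega_{F_S}$ for the sheaf of relative differentials of the morphism $F_S$. Let $V$ be an ample vector bundle on $S$ (that is, a locally free sheaf of finite rank such that, for every coherent sheaf $G$ on $S$, the sheaf $G\otimes {\rm Sym}^n(V)$ is generated by its global sections for all sufficiently large $n$), with dual $V^\vee$. Let $n_0\geq 0$ be an integer such that $$H^0(S,F_S^{n,*}(V^\vee)\otimes\Omega_{F_S})=0\quad\text{for all } n>n_0 .$$ Let $S'$ be an irreducible scheme and let $\phi:S'\to S$ be a finite morphism which is generically inseparable, i.e. $\phi$ is dominant and the residue field at the generic point of $S'$ is a purely inseparable (possibly trivial) extension of the function field of $S$. Then the pull-back map $$H^1(S,F_S^{n_0,*}(V^\vee))\to H^1(S',\phi^*(F_S^{n_0,*}(V^\vee)))$$ is injective. -/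

import Mathlib

open CategoryTheory Limits TopologicalSpace Opposite AlgebraicGeometry

universe u

noncomputable section

namespace FrobeniusPullback

variable {X Y : Scheme.{u}}

/-! ### Sheafification, vector bundles, dual -/

/-- The sheaf of `𝒪_X`-modules associated with a presheaf of `𝒪_X`-modules. -/
def sheafify (P : X.PresheafOfModules) : X.Modules :=
  (PresheafOfModules.sheafification (𝟙 X.ringCatSheaf.obj)).obj P

/-- The tensor product `M ⊗ N` of sheaves of `𝒪_X`-modules: the sheafification of
`U ↦ M(U) ⊗ N(U)`. -/
def tensor (M N : X.Modules) : X.Modules :=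
  sheafify (PresheafOfModules.Monoidal.tensorObj (R := X.presheaf) M.val N.val)

/-- A vector bundle: a locally free sheaf of finite rank. -/
def IsVectorBundle (M : X.Modules) : Prop :=
  ∃ q : SheafOfModules.LocalGeneratorsData.{u} (R := X.ringCatSheaf) M,
    q.IsLocallyFreeData ∧ q.IsFiniteType

/-- Sections over `U` of the dual of `M`, i.e. morphisms of sheaves of modules `M|_U ⟶ 𝒪_U`: families
of `𝒪(W)`-linear maps `M(W) → 𝒪(W)`, for `W ⊆ U` open, which are compatible with restriction. -/
def dualSections (M : X.Modules) (U : X.Opens) :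
    AddSubgroup (∀ W : {W : X.Opens // W ≤ U}, Γ(M, W.1) →ₗ[Γ(X, W.1)] Γ(X, W.1)) where
  carrier := {φ | ∀ (W₁ W₂ : X.Opens) (h₁₂ : W₁ ≤ W₂) (h₂ : W₂ ≤ U) (m : Γ(M, W₂)),
    φ ⟨W₁, h₁₂.trans h₂⟩ (M.presheaf.map (homOfLE h₁₂).op m) =
      X.presheaf.map (homOfLE h₁₂).op (φ ⟨W₂, h₂⟩ m)}
  zero_mem' := by intro W₁ W₂ h₁₂ h₂ m; simp
  add_mem' := by
    intro φ ψ hφ hψ W₁ W₂ h₁₂ h₂ m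
    simp [hφ W₁ W₂ h₁₂ h₂ m, hψ W₁ W₂ h₁₂ h₂ m]
  neg_mem' := by
    intro φ hφ W₁ W₂ h₁₂ h₂ m
    simp [hφ W₁ W₂ h₁₂ h₂ m]

instance (M : X.Modules) (U : X.Opens) : Module Γ(X, U) (dualSections M U) where
  smul r φ := ⟨fun W ↦ X.presheaf.map (homOfLE W.2).op r • φ.1 W, by
    intro W₁ W₂ h₁₂ h₂ m
    simp only [LinearMap.smul_apply, smul_eq_mul, map_mul, φ.2 W₁ W₂ h₁₂ h₂ m]
    rw [← CommRingCat.comp_apply, ← Functor.map_comp]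
    rfl⟩
  one_smul φ := by
    refine Subtype.ext (funext fun W ↦ LinearMap.ext fun m ↦ ?_)
    change X.presheaf.map _ 1 * _ = _
    simp
  mul_smul r s φ := by
    refine Subtype.ext (funext fun W ↦ LinearMap.ext fun m ↦ ?_)
    change X.presheaf.map _ (r * s) * _ = _ * (_ * _)
    rw [map_mul, mul_assoc]
  smul_zero r := by
    refine Subtype.ext (funext fun W ↦ LinearMap.ext fun m ↦ ?_)
    exact mul_zero _
  smul_add r φ ψ := by
    refine Subtype.ext (funext fun W ↦ LinearMap.ext fun m ↦ ?_)
    exact mul_add _ _ _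
  add_smul r s φ := by
    refine Subtype.ext (funext fun W ↦ LinearMap.ext fun m ↦ ?_)
    change X.presheaf.map _ (r + s) * _ = _ * _ + _ * _
    rw [map_add, add_mul]
  zero_smul φ := by
    refine Subtype.ext (funext fun W ↦ LinearMap.ext fun m ↦ ?_)
    change X.presheaf.map _ 0 * _ = 0
    rw [map_zero, zero_mul]

/-- Restriction of sections of the dual to a smaller open subset. -/
def dualRestrict (M : X.Modules) {U V : X.Opens} (h : V ≤ U) :
    dualSections M U →+ dualSections M V where
  toFun φ := ⟨fun W ↦ φ.1 ⟨W.1, W.2.trans h⟩, fun W₁ W₂ h₁₂ h₂ m ↦ φ.2 W₁ W₂ h₁₂ (h₂.trans h) m⟩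
  map_zero' := rfl
  map_add' _ _ := rfl

lemma dualRestrict_smul (M : X.Modules) {U V : X.Opens} (h : V ≤ U) (r : Γ(X, U))
    (φ : dualSections M U) :
    dualRestrict M h (r • φ) = X.presheaf.map (homOfLE h).op r • dualRestrict M h φ := by
  refine Subtype.ext (funext fun W ↦ LinearMap.ext fun m ↦ ?_)
  change X.presheaf.map _ r * _ = X.presheaf.map _ (X.presheaf.map _ r) * _
  rw [← CommRingCat.comp_apply, ← Functor.map_comp]
  rfl

/-- The abelian presheaf underlying the dual of `M`. -/
def dualAb (M : X.Modules) : TopCat.Presheaf Ab.{u} X where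
  obj U := AddCommGrpCat.of (dualSections M U.unop)
  map f := AddCommGrpCat.ofHom (dualRestrict M f.unop.le)
  map_id _ := rfl
  map_comp _ _ := rfl

instance (M : X.Modules) (U : X.Opensᵒᵖ) : Module (X.ringCatSheaf.obj.obj U) ((dualAb M).obj U) :=
  inferInstanceAs (Module Γ(X, U.unop) (dualSections M U.unop))

/-- The presheaf of modules underlying the dual of `M`. -/
def dualPresheaf (M : X.Modules) : X.PresheafOfModules :=
  PresheafOfModules.ofPresheaf (R := X.ringCatSheaf.obj) (dualAb M)
    (fun _ _ f r φ ↦ dualRestrict_smul M f.unop.le r φ)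

lemma dualAb_isSheaf (M : X.Modules) : (dualAb M).IsSheaf := by
  rw [TopCat.Presheaf.isSheaf_iff_isSheafUniqueGluing]
  intro ι U sf' hsf'
  let sf : ∀ i, dualSections M (U i) := sf'
  have key : ∀ (i j : ι) (W : X.Opens) (hi : W ≤ U i) (hj : W ≤ U j),
      (sf i).1 ⟨W, hi⟩ = (sf j).1 ⟨W, hj⟩ := by
    intro i j W hi hj
    exact congrFun (congrArg Subtype.val (hsf' i j)) ⟨W, le_inf hi hj⟩
  have hcov : ∀ W : X.Opens, W ≤ iSup U → W ≤ ⨆ i, W ⊓ U i := fun W h ↦ by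
    rw [← inf_iSup_eq]; exact le_inf le_rfl h
  have ex : ∀ (W : X.Opens) (hW : W ≤ iSup U) (m : Γ(M, W)), ∃! s : Γ(X, W),
      ∀ i, X.presheaf.map (homOfLE (inf_le_left : W ⊓ U i ≤ W)).op s =
        (sf i).1 ⟨W ⊓ U i, inf_le_right⟩
          (M.presheaf.map (homOfLE (inf_le_left : W ⊓ U i ≤ W)).op m) := by
    intro W hW m
    refine X.sheaf.existsUnique_gluing' (fun i ↦ W ⊓ U i) W (fun i ↦ homOfLE inf_le_left)
      (hcov W hW) _ ?_
    intro i j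
    have h1 := (sf i).2 (W ⊓ U i ⊓ (W ⊓ U j)) (W ⊓ U i) inf_le_left inf_le_right
      (M.presheaf.map (homOfLE (inf_le_left : W ⊓ U i ≤ W)).op m)
    have h2 := (sf j).2 (W ⊓ U i ⊓ (W ⊓ U j)) (W ⊓ U j) inf_le_right inf_le_right
      (M.presheaf.map (homOfLE (inf_le_left : W ⊓ U j ≤ W)).op m)
    refine h1.symm.trans (Eq.trans ?_ h2)
    rw [key i j _ (inf_le_left.trans inf_le_right) (inf_le_right.trans inf_le_right)]
    congr 1
    rw [← AddCommGrpCat.comp_apply, ← AddCommGrpCat.comp_apply, ← Functor.map_comp,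
      ← Functor.map_comp]
    rfl
  have eq_of : ∀ (W : X.Opens) (hW : W ≤ iSup U) (s t : Γ(X, W)),
      (∀ i, X.presheaf.map (homOfLE (inf_le_left : W ⊓ U i ≤ W)).op s =
        X.presheaf.map (homOfLE (inf_le_left : W ⊓ U i ≤ W)).op t) → s = t := fun W hW s t h ↦
    X.sheaf.eq_of_locally_eq' (fun i ↦ W ⊓ U i) W (fun i ↦ homOfLE inf_le_left) (hcov W hW) s t h
  choose g hg _ using ex
  let φ : ∀ W : {W : X.Opens // W ≤ iSup U}, Γ(M, W.1) →ₗ[Γ(X, W.1)] Γ(X, W.1) := fun ⟨W, hW⟩ ↦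
    { toFun := g W hW
      map_add' := fun a b ↦ eq_of W hW _ _ fun i ↦ by
        rw [map_add, hg, hg, hg, map_add, map_add]
      map_smul' := fun r a ↦ eq_of W hW _ _ fun i ↦ by
        rw [RingHom.id_apply, smul_eq_mul, map_mul, hg, hg, Scheme.Modules.map_smul, map_smul,
          smul_eq_mul] }
  have hφ : ∀ (i : ι) (W : X.Opens) (hW : W ≤ iSup U) (hi : W ≤ U i) (m : Γ(M, W)),
      φ ⟨W, hW⟩ m = (sf i).1 ⟨W, hi⟩ m := by
    intro i W hW hi m
    refine eq_of W hW _ _ fun j ↦ ?_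
    refine (hg W hW m j).trans ?_
    rw [key j i _ inf_le_right (inf_le_left.trans hi)]
    exact (sf i).2 _ _ inf_le_left hi m
  refine ⟨⟨φ, ?_⟩, ?_, ?_⟩
  · intro W₁ W₂ h₁₂ h₂ m
    refine eq_of W₁ (h₁₂.trans h₂) _ _ fun i ↦ ?_
    refine (hg W₁ (h₁₂.trans h₂) _ i).trans ?_
    have h1 := (sf i).2 (W₁ ⊓ U i) (W₂ ⊓ U i) (inf_le_inf_right _ h₁₂) inf_le_right
      (M.presheaf.map (homOfLE (inf_le_left : W₂ ⊓ U i ≤ W₂)).op m)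
    have h2 := hg W₂ h₂ m i
    rw [← h2] at h1
    rw [← CommRingCat.comp_apply, ← Functor.map_comp] at h1 ⊢
    rw [← AddCommGrpCat.comp_apply, ← Functor.map_comp] at h1 ⊢
    exact h1
  · intro i
    refine Subtype.ext (funext fun W ↦ LinearMap.ext fun m ↦ ?_)
    exact hφ i W.1 (W.2.trans (le_iSup U i)) W.2 m
  · intro ψ hψ
    refine Subtype.ext (funext fun W ↦ LinearMap.ext fun m ↦ ?_)
    refine eq_of W.1 W.2 _ _ fun i ↦ ?_
    refine (((ψ : dualSections M (iSup U)).2 (W.1 ⊓ U i) W.1 inf_le_left W.2 m).symm.trans ?_).trans (hg W.1 W.2 m i).symm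
    exact LinearMap.congr_fun (congrFun (congrArg Subtype.val (hψ i)) ⟨W.1 ⊓ U i, inf_le_right⟩) _

/-- The dual `M^∨ = ℋom(M, 𝒪_X)` of a sheaf of modules. -/
def dual (M : X.Modules) : X.Modules where
  val := dualPresheaf M
  isSheaf := dualAb_isSheaf M

/-! ### Symmetric powers and ampleness -/

section
variable {R R' R'' M M' M'' : Type u} [CommRing R] [CommRing R'] [CommRing R'']
  [AddCommGroup M] [AddCommGroup M'] [AddCommGroup M''] [Module R M] [Module R' M'] [Module R'' M'']

/-- The ring homomorphism between symmetric algebras induced by a semilinear map. -/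
def symAlgMap (σ : R →+* R') (g : M →ₛₗ[σ] M') : SymmetricAlgebra R M →+* SymmetricAlgebra R' M' :=
  letI : Algebra R (SymmetricAlgebra R' M') := Algebra.compHom _ σ
  (SymmetricAlgebra.lift (R := R) (M := M) (A := SymmetricAlgebra R' M')
    { toFun := fun m ↦ SymmetricAlgebra.ι R' M' (g m)
      map_add' := fun a b ↦ by rw [map_add, map_add]
      map_smul' := fun r a ↦ by rw [map_smulₛₗ, map_smul]; rfl }).toRingHom

lemma symAlgMap_ι (σ : R →+* R') (g : M →ₛₗ[σ] M') (m : M) :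
    symAlgMap σ g (SymmetricAlgebra.ι R M m) = SymmetricAlgebra.ι R' M' (g m) :=
  letI : Algebra R (SymmetricAlgebra R' M') := Algebra.compHom _ σ
  SymmetricAlgebra.lift_ι_apply _ m

lemma symAlgMap_algebraMap (σ : R →+* R') (g : M →ₛₗ[σ] M') (r : R) :
    symAlgMap σ g (algebraMap R _ r) = algebraMap R' _ (σ r) :=
  letI : Algebra R (SymmetricAlgebra R' M') := Algebra.compHom _ σ
  AlgHom.commutes (SymmetricAlgebra.lift (R := R) (M := M) (A := SymmetricAlgebra R' M') _) r

lemma symAlgMap_smul (σ : R →+* R') (g : M →ₛₗ[σ] M') (r : R) (a : SymmetricAlgebra R M) :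
    symAlgMap σ g (r • a) = σ r • symAlgMap σ g a := by
  rw [Algebra.smul_def, Algebra.smul_def, map_mul, symAlgMap_algebraMap]

lemma symAlgMap_id (g : M →ₗ[R] M) (hg : ∀ m, g m = m) (a : SymmetricAlgebra R M) :
    symAlgMap (RingHom.id R) g a = a := by
  induction a using SymmetricAlgebra.induction with
  | algebraMap r => simp [symAlgMap_algebraMap]
  | ι x => rw [symAlgMap_ι, hg]
  | mul a b ha hb => rw [map_mul, ha, hb]
  | add a b ha hb => rw [map_add, ha, hb]

lemma symAlgMap_congr {σ σ' : R →+* R'} {g : M →ₛₗ[σ] M'} {g' : M →ₛₗ[σ'] M'}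
    (hσ : ∀ r, σ r = σ' r) (hg : ∀ m, g m = g' m) (a : SymmetricAlgebra R M) :
    symAlgMap σ g a = symAlgMap σ' g' a := by
  induction a using SymmetricAlgebra.induction with
  | algebraMap r => simp [symAlgMap_algebraMap, hσ]
  | ι x => rw [symAlgMap_ι, symAlgMap_ι, hg]
  | mul a b ha hb => rw [map_mul, map_mul, ha, hb]
  | add a b ha hb => rw [map_add, map_add, ha, hb]

lemma symAlgMap_comp (σ : R →+* R') (g : M →ₛₗ[σ] M') (τ : R' →+* R'') (h : M' →ₛₗ[τ] M'')
    (ρ : R →+* R'') (k : M →ₛₗ[ρ] M'') (hρ : ∀ r, ρ r = τ (σ r)) (hk : ∀ m, k m = h (g m))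
    (a : SymmetricAlgebra R M) :
    symAlgMap ρ k a = symAlgMap τ h (symAlgMap σ g a) := by
  induction a using SymmetricAlgebra.induction with
  | algebraMap r => simp [symAlgMap_algebraMap, hρ]
  | ι x => rw [symAlgMap_ι, symAlgMap_ι, symAlgMap_ι, hk]
  | mul a b ha hb => simp only [map_mul, ha, hb]
  | add a b ha hb => simp only [map_add, ha, hb]

variable (R M) in
/-- The `n`-th symmetric power of `M`, as the degree `n` part of the symmetric algebra: the span of
the products of `n` elements of `M`. -/
def symPow (n : ℕ) : Submodule R (SymmetricAlgebra R M) :=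
  LinearMap.range (SymmetricAlgebra.ι R M) ^ n

lemma symAlgMap_mem (σ : R →+* R') (g : M →ₛₗ[σ] M') (n : ℕ) {a : SymmetricAlgebra R M}
    (ha : a ∈ symPow R M n) : symAlgMap σ g a ∈ symPow R' M' n := by
  induction ha using Submodule.pow_induction_on_left' with
  | algebraMap r =>
    rw [symAlgMap_algebraMap, symPow, pow_zero]
    exact Submodule.algebraMap_mem _
  | add x y i _ _ hx hy => rw [map_add]; exact add_mem hx hy
  | mem_mul m hm i x _ hx =>
    obtain ⟨m, rfl⟩ := hm
    rw [map_mul, symAlgMap_ι, symPow, pow_succ']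
    exact Submodule.mul_mem_mul ⟨_, rfl⟩ hx

end

/-- Restriction of sections of `M`, as a semilinear map. -/
def restrictₛₗ (M : X.Modules) {U V : X.Opens} (f : V ⟶ U) :
    Γ(M, U) →ₛₗ[(X.presheaf.map f.op).hom] Γ(M, V) where
  toFun m := M.presheaf.map f.op m
  map_add' := map_add _
  map_smul' r m := M.map_smul f r m

/-- Restriction of sections of the symmetric power presheaf. -/
def symRestrict (M : X.Modules) (n : ℕ) {U V : X.Opens} (f : V ⟶ U) :
    symPow Γ(X, U) Γ(M, U) n →+ symPow Γ(X, V) Γ(M, V) n where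
  toFun a := ⟨symAlgMap _ (restrictₛₗ M f) a.1, symAlgMap_mem _ _ n a.2⟩
  map_zero' := Subtype.ext (map_zero _)
  map_add' _ _ := Subtype.ext (map_add _ _ _)

lemma symRestrict_smul (M : X.Modules) (n : ℕ) {U V : X.Opens} (f : V ⟶ U) (r : Γ(X, U))
    (a : symPow Γ(X, U) Γ(M, U) n) :
    symRestrict M n f (r • a) = X.presheaf.map f.op r • symRestrict M n f a :=
  Subtype.ext (symAlgMap_smul _ _ r a.1)

/-- The abelian presheaf `U ↦ Sym^n M(U)`. -/
def symAb (M : X.Modules) (n : ℕ) : TopCat.Presheaf Ab.{u} X where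
  obj U := AddCommGrpCat.of (symPow Γ(X, U.unop) Γ(M, U.unop) n)
  map f := AddCommGrpCat.ofHom (symRestrict M n f.unop)
  map_id U := by
    refine AddCommGrpCat.ext fun a ↦ Subtype.ext ?_
    refine (symAlgMap_congr (σ' := RingHom.id _) (g' := LinearMap.id) (fun r ↦ ?_) (fun m ↦ ?_)
      a.1).trans (symAlgMap_id _ (fun _ ↦ rfl) _)
    · exact CategoryTheory.congr_fun (X.presheaf.map_id U) r
    · exact CategoryTheory.congr_fun (M.presheaf.map_id U) m
  map_comp f g := by
    refine AddCommGrpCat.ext fun a ↦ Subtype.ext ?_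
    refine symAlgMap_comp _ _ _ _ _ _ (fun r ↦ ?_) (fun m ↦ ?_) a.1
    · exact CategoryTheory.congr_fun (X.presheaf.map_comp f g) r
    · exact CategoryTheory.congr_fun (M.presheaf.map_comp f g) m

instance (M : X.Modules) (n : ℕ) (U : X.Opensᵒᵖ) :
    Module (X.ringCatSheaf.obj.obj U) ((symAb M n).obj U) :=
  inferInstanceAs (Module Γ(X, U.unop) (symPow Γ(X, U.unop) Γ(M, U.unop) n))

/-- The presheaf of modules `U ↦ Sym^n M(U)`. -/
def symPresheaf (M : X.Modules) (n : ℕ) : X.PresheafOfModules :=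
  PresheafOfModules.ofPresheaf (R := X.ringCatSheaf.obj) (symAb M n)
    (fun _ _ f r a ↦ symRestrict_smul M n f.unop r a)

/-- The symmetric power `Sym^n M` of a sheaf of modules. -/
def symSheaf (M : X.Modules) (n : ℕ) : X.Modules := sheafify (symPresheaf M n)

/-- `M` is generated by its global sections. -/
def IsGloballyGenerated (M : X.Modules) : Prop :=
  Nonempty (SheafOfModules.GeneratingSections (R := X.ringCatSheaf) M)

/-- Coherent sheaves. On a locally noetherian scheme these are the sheaves of modules which are
locally of finite presentation. -/
def IsCoherent (M : X.Modules) : Prop :=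
  SheafOfModules.IsFinitePresentation (R := X.ringCatSheaf) M

/-- A vector bundle `V` is ample (Hartshorne's definition) if for every coherent sheaf `F` the sheaf
`F ⊗ Sym^n V` is generated by its global sections for all sufficiently large `n`. -/
structure IsAmpleBundle (V : X.Modules) : Prop where
  isVectorBundle : IsVectorBundle V
  isGloballyGenerated : ∀ F : X.Modules, IsCoherent F →
    ∃ n₁ : ℕ, ∀ n : ℕ, n₁ ≤ n → IsGloballyGenerated (tensor F (symSheaf V n))

/-! ### Frobenius and differentials -/

/-- The Frobenius endomorphism `x ↦ x ^ p` of a ring in which `p = 0` (possibly the zero ring). -/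
def frobRingHom (p : ℕ) [Fact p.Prime] (R : Type u) [CommRing R] (h : (p : R) = 0) : R →+* R where
  toFun x := x ^ p
  map_one' := one_pow p
  map_mul' x y := mul_pow x y p
  map_zero' := zero_pow (Fact.out : p.Prime).ne_zero
  map_add' x y := by
    rcases subsingleton_or_nontrivial R with _ | _
    · exact Subsingleton.elim _ _
    · have : CharP R p := (CharP.charP_iff_prime_eq_zero Fact.out).mpr h
      exact add_pow_char x y p

lemma natCast_section (p : ℕ) (h : (p : Γ(X, ⊤)) = 0) (U : X.Opens) : (p : Γ(X, U)) = 0 := by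
  have := congrArg (X.presheaf.map (homOfLE (le_top : U ≤ ⊤)).op) h
  rwa [map_natCast, map_zero] at this

/-- The absolute Frobenius endomorphism `F_X` of a scheme `X` on which `p = 0`: the identity on the
underlying space and `x ↦ x ^ p` on functions. -/
def absoluteFrobenius (p : ℕ) [Fact p.Prime] (X : Scheme.{u}) (h : (p : Γ(X, ⊤)) = 0) : X ⟶ X where
  base := 𝟙 _
  c :=
    { app := fun U ↦ CommRingCat.ofHom (frobRingHom p Γ(X, U.unop) (natCast_section p h U.unop))
      naturality := fun U V f ↦ by
        ext x
        exact (map_pow (X.presheaf.map f).hom x p).symm }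
  prop x := by
    refine ⟨fun a ha ↦ ?_⟩
    obtain ⟨U, hx, s, rfl⟩ := X.presheaf.exists_germ_eq a
    rw [PresheafedSpace.stalkMap_germ_apply] at ha
    change IsUnit (X.presheaf.germ U x hx (s ^ p)) at ha
    rw [map_pow] at ha
    exact (isUnit_pow_iff (Fact.out : p.Prime).ne_zero).mp ha

lemma natCast_eq_zero_of_hom (p : ℕ) {k : Type u} [Field k] [CharP k p] (π : X ⟶ Spec (.of k)) :
    (p : Γ(X, ⊤)) = 0 := by
  let σ : k →+* Γ(X, ⊤) := ((Scheme.ΓSpecIso (.of k)).inv ≫ π.appTop).hom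
  rw [← map_natCast σ p, CharP.cast_eq_zero k p, map_zero]

/-- The `n`-th iterate `F_X^n` of the absolute Frobenius endomorphism. -/
def iteratedFrobenius (p : ℕ) [Fact p.Prime] (X : Scheme.{u}) (h : (p : Γ(X, ⊤)) = 0) :
    ℕ → (X ⟶ X)
  | 0 => 𝟙 X
  | n + 1 => iteratedFrobenius p X h n ≫ absoluteFrobenius p X h

/-- The sheaf of relative differentials `Ω_f` of a morphism `f : X ⟶ Y`: the sheafification of
`U ↦ Ω_{𝒪_X(U) / (f⁻¹𝒪_Y)(U)}`, where `f⁻¹𝒪_Y` is the presheaf inverse image. -/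
def relativeDifferentials (f : X ⟶ Y) : X.Modules :=
  sheafify (PresheafOfModules.DifferentialsConstruction.relativeDifferentials'
    (((TopCat.Presheaf.pullbackPushforwardAdjunction CommRingCat.{u} f.base).homEquiv _ _).symm
      f.c))

/-! ### Cohomology and pull-back -/

/-- Sheaves of abelian groups on (the Zariski site of) a scheme. -/
abbrev AbSheaf (X : Scheme.{u}) : Type (u + 1) :=
  Sheaf (Opens.grothendieckTopology X) AddCommGrpCat.{u}

/-- The sheaf of abelian groups underlying a sheaf of modules. -/
def toAbSheaf (M : X.Modules) : AbSheaf X := ⟨M.presheaf, M.isSheaf⟩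

/-- The cohomology groups `H^n(X, M)` of a sheaf of modules. -/
abbrev Cohomology (M : X.Modules) (n : ℕ) : Type u := Sheaf.H.{u} (toAbSheaf M) n

/-- The inverse image functor `f⁻¹` on abelian sheaves. -/
def inverseImage (f : X ⟶ Y) : AbSheaf Y ⥤ AbSheaf X :=
  (Opens.map f.base).sheafPullback AddCommGrpCat.{u} (Opens.grothendieckTopology Y)
    (Opens.grothendieckTopology X)

/-- The direct image functor `f_*` on abelian sheaves. -/
def directImage (f : X ⟶ Y) : AbSheaf X ⥤ AbSheaf Y :=
  (Opens.map f.base).sheafPushforwardContinuous AddCommGrpCat.{u} (Opens.grothendieckTopology Y)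
    (Opens.grothendieckTopology X)

/-- The adjunction between `f⁻¹` and `f_*`. -/
def inverseImageAdj (f : X ⟶ Y) : inverseImage f ⊣ directImage f :=
  (Opens.map f.base).sheafAdjunctionContinuous _ _ _

instance (f : X ⟶ Y) : PreservesFiniteLimits (inverseImage f) := by
  unfold inverseImage
  apply Functor.SmallCategories.instPreservesFiniteLimitsSheafSheafPullbackOfRepresentablyFlat

instance (f : X ⟶ Y) : PreservesFiniteColimits (inverseImage f) :=
  have := (inverseImageAdj f).leftAdjoint_preservesColimits
  inferInstance

instance (f : X ⟶ Y) : (inverseImage f).Additive :=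
  have := preservesBinaryBiproducts_of_preservesBinaryProducts (inverseImage f)
  Functor.additive_of_preservesBinaryBiproducts _

/-- The constant sheaf `ℤ_X`. -/
def constantZ (X : Scheme.{u}) : AbSheaf X :=
  (constantSheaf (Opens.grothendieckTopology X) AddCommGrpCat.{u}).obj
    (AddCommGrpCat.of (ULift ℤ))

/-- The canonical morphism `ℤ_X ⟶ f⁻¹ ℤ_Y` of abelian sheaves. -/
def constComparison (f : X ⟶ Y) : constantZ X ⟶ (inverseImage f).obj (constantZ Y) :=
  ((constantSheafAdj (Opens.grothendieckTopology X) AddCommGrpCat.{u}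
    (isTerminalTop : IsTerminal (⊤ : X.Opens))).homEquiv _ _).symm
    ((constantSheafAdj (Opens.grothendieckTopology Y) AddCommGrpCat.{u}
      (isTerminalTop : IsTerminal (⊤ : Y.Opens))).homEquiv _ _
      ((inverseImageAdj f).unit.app (constantZ Y)))

/-- The canonical morphism of abelian sheaves `f⁻¹ M ⟶ f^* M`. -/
def inverseImageToPullback (f : X ⟶ Y) (M : Y.Modules) :
    (inverseImage f).obj (toAbSheaf M) ⟶ toAbSheaf ((Scheme.Modules.pullback f).obj M) :=
  ((inverseImageAdj f).homEquiv _ _).symm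
    ⟨((Scheme.Modules.pullbackPushforwardAdjunction f).unit.app M).mapPresheaf⟩

/-- The pull-back map `H^n(Y, M) → H^n(X, f^* M)`: the composition of the map
`H^n(Y, M) = Ext^n(ℤ_Y, M) → Ext^n(ℤ_X, f⁻¹ M) = H^n(X, f⁻¹ M)` given by the exact functor `f⁻¹`, with
the map induced by `f⁻¹ M ⟶ f^* M`. -/
def cohomologyPullback (f : X ⟶ Y) (M : Y.Modules) (n : ℕ) :
    Cohomology M n →+ Cohomology ((Scheme.Modules.pullback f).obj M) n :=
  ((Sheaf.H.map (inverseImageToPullback f M) n).comp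
    ((Abelian.Ext.mk₀ (constComparison f)).precomp
      ((inverseImage f).obj (toAbSheaf M)) (zero_add n))).comp
    (Functor.mapExtAddHom (inverseImage f) _ _ n)

/-! ### Projective, normal, generically inseparable -/

section ProjectiveSpace

attribute [local instance] MvPolynomial.gradedAlgebra

/-- Projective space of dimension `n` over a field. -/
def projectiveSpace (k : Type u) [Field k] (n : ℕ) : Scheme.{u} :=
  Proj (MvPolynomial.homogeneousSubmodule (Fin (n + 1)) k)

/-- The structure morphism of projective space. -/
def projectiveSpaceToSpec (k : Type u) [Field k] (n : ℕ) :
    projectiveSpace k n ⟶ Spec (.of k) :=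
  Proj.toSpecZero (MvPolynomial.homogeneousSubmodule (Fin (n + 1)) k) ≫
    Spec.map (CommRingCat.ofHom (algebraMap k _))

end ProjectiveSpace

/-- A scheme over a field is projective if it is isomorphic over this field to a closed subscheme of
a projective space. -/
def IsProjectiveOver {k : Type u} [Field k] (π : X ⟶ Spec (.of k)) : Prop :=
  ∃ (n : ℕ) (i : X ⟶ projectiveSpace k n), IsClosedImmersion i ∧ i ≫ projectiveSpaceToSpec k n = π

/-- A scheme is normal if its local rings are integrally closed domains. -/
def IsNormalScheme (X : Scheme.{u}) : Prop :=
  ∀ x : X, IsDomain (X.presheaf.stalk x) ∧ IsIntegrallyClosed (X.presheaf.stalk x)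

/-- A morphism `φ : X ⟶ Y`, where `X` is irreducible, is generically inseparable if it is dominant
and if the extension of residue fields at the generic points is purely inseparable. -/
structure IsGenericallyInseparable (φ : X ⟶ Y) [IrreducibleSpace X] : Prop where
  isDominant : IsDominant φ
  isPurelyInseparable :
    letI := (φ.residueFieldMap (genericPoint X)).hom.toAlgebra
    IsPurelyInseparable (Y.residueField (φ (genericPoint X))) (X.residueField (genericPoint X))

end FrobeniusPullback

end

open FrobeniusPullback

/-!
Let `F` be the absolute Frobenius of a normal integral scheme `S` and `M` a locally free sheaf. The
pull-back `F^* M` carries the connection `∇ : F^* M ⟶ F^* M ⊗ Ω_F` which kills the sections pulled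
back from `M`. Conversely, an element of the function field that is killed by every derivation is a
`p`-th power, so by normality the horizontal sections of `F^* M` are exactly the sections of `M`.

A class in `H¹(S, M)` is an extension `0 ⟶ M ⟶ E ⟶ ℤ ⟶ 0`. If it dies after pull-back along `F`, the
map `M ⟶ F_* F^* M` extends to `h : E ⟶ F_* F^* M`, and `∇ ∘ h` kills `M`, so that it is a global
section of `F^* M ⊗ Ω_F`. When there are no such sections but `0`, the map `h` takes horizontal
values, that is, it is a retraction of `E` onto `M`, and the class was zero already.

So Frobenius pull-backs can be removed one by one. Finally a finite generically inseparable
morphism `f : X ⟶ S` is dominated by an iterate of `F`: for large `n` the `p ^ n`-th power of a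
function on `X` is, modulo nilpotents, generically a function on `S`, hence a function on `S` by
normality, and this defines a morphism `g : S ⟶ X` with `g ≫ f = F ^ n`.
-/

noncomputable section

namespace FrobeniusPullback

open Abelian

variable {X Y Z : Scheme.{u}}

/-! ### Extensions and adjunctions -/

section Ext

universe v w w'

variable {C : Type*} [Category.{v} C] [Abelian C] {D : Type*} [Category.{v} D] [Abelian D]

lemma shortExact_of_isPullback {S : ShortComplex C} (hS : S.ShortExact) {E Z : C} {a : E ⟶ S.X₂}
    {b : E ⟶ Z} {q : Z ⟶ S.X₃} (sq : IsPullback a b S.g q) :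
    (ShortComplex.mk (sq.lift S.f 0 (by simp)) b (sq.lift_snd _ _ _)).ShortExact := by
  have := hS.mono_f
  have := hS.epi_g
  have : Epi b := by rw [← sq.isoPullback_hom_snd]; infer_instance
  have : Mono (sq.lift S.f 0 (by simp)) := mono_of_mono_fac (sq.lift_fst S.f 0 (by simp))
  refine ⟨ShortComplex.exact_of_f_is_kernel _ (KernelFork.IsLimit.ofι' _ _ fun {A} k hk ↦ ?_)⟩
  have hk' : (k ≫ a) ≫ S.g = 0 := by
    rw [Category.assoc, sq.w, ← Category.assoc, hk, zero_comp]
  refine ⟨hS.exact.lift _ hk', sq.hom_ext ?_ ?_⟩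
  · rw [Category.assoc, sq.lift_fst, hS.exact.lift_f]
  · rw [Category.assoc, sq.lift_snd, comp_zero, hk]

variable [HasExt.{w} C]

lemma extClass_of_isPullback {S : ShortComplex C} (hS : S.ShortExact) {E Z : C} {a : E ⟶ S.X₂}
    {b : E ⟶ Z} {q : Z ⟶ S.X₃} (sq : IsPullback a b S.g q) :
    (shortExact_of_isPullback hS sq).extClass =
      (Ext.mk₀ q).comp hS.extClass (zero_add 1) := by
  let φ : ShortComplex.mk _ b (sq.lift_snd S.f 0 (by simp)) ⟶ S :=
    { τ₁ := 𝟙 _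
      τ₂ := a
      τ₃ := q
      comm₁₂ := by simp
      comm₂₃ := sq.w }
  have h := ShortComplex.ShortExact.extClass_naturality (shortExact_of_isPullback hS sq) hS φ
  rwa [Ext.comp_mk₀_id] at h

lemma exists_shortExact_extClass_eq [EnoughInjectives C] {Z M : C} (c : Ext.{w} Z M 1) :
    ∃ (E : C) (i : M ⟶ E) (q : E ⟶ Z) (hz : i ≫ q = 0)
      (hS : (ShortComplex.mk i q hz).ShortExact), hS.extClass = c := by
  let S : ShortComplex C := .mk (Injective.ι M) (cokernel.π (Injective.ι M)) (cokernel.condition _)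
  have hS : S.ShortExact :=
    { exact := ShortComplex.exact_cokernel _
      mono_f := by dsimp only [S]; infer_instance
      epi_g := by dsimp only [S]; infer_instance }
  obtain ⟨q, hq⟩ := Ext.covariant_sequence_exact₁ Z hS c (Ext.eq_zero_of_injective _) (zero_add 1)
  obtain ⟨q, rfl⟩ := (Ext.mk₀_bijective _ _).2 q
  exact ⟨_, _, _, _, _, (extClass_of_isPullback hS (IsPullback.of_hasPullback S.g q)).trans hq⟩

lemma extClass_eq_zero_of_retraction {S : ShortComplex C} (hS : S.ShortExact)
    (r : S.X₂ ⟶ S.X₁) (hr : S.f ≫ r = 𝟙 _) : hS.extClass = 0 := by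
  rw [← Ext.comp_mk₀_id hS.extClass, ← hr, ← Ext.mk₀_comp_mk₀,
    ← Ext.comp_assoc_of_third_deg_zero, hS.extClass_comp, Ext.zero_comp]

lemma exists_extension_of_extClass_comp_eq_zero {S : ShortComplex C} (hS : S.ShortExact) {N : C}
    (a : S.X₁ ⟶ N) (h : hS.extClass.comp (Ext.mk₀ a) (add_zero 1) = 0) :
    ∃ k : S.X₂ ⟶ N, S.f ≫ k = a := by
  obtain ⟨k, hk⟩ := Ext.contravariant_sequence_exact₁ hS _ _ (add_zero 1) h
  obtain ⟨k, rfl⟩ := (Ext.mk₀_bijective _ _).2 k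
  rw [Ext.mk₀_comp_mk₀] at hk
  exact ⟨k, (Ext.mk₀_bijective _ _).1 hk⟩

lemma exists_adjoint_extension_of_mapExt_eq_zero [HasExt.{w'} D] {L : C ⥤ D} {R : D ⥤ C}
    (adj : L ⊣ R) [L.Additive] [PreservesFiniteLimits L] [PreservesFiniteColimits L]
    {S : ShortComplex C} (hS : S.ShortExact) {N : D} (a : L.obj S.X₁ ⟶ N)
    (h : (hS.extClass.mapExactFunctor L).comp (Ext.mk₀ a) (add_zero 1) = 0) :
    ∃ k : S.X₂ ⟶ R.obj N, S.f ≫ k = adj.homEquiv _ _ a := by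
  obtain ⟨k, hk⟩ : ∃ k : L.obj S.X₂ ⟶ N, L.map S.f ≫ k = a :=
    exists_extension_of_extClass_comp_eq_zero (hS.map_of_exact L) a
      ((congrArg (Ext.comp · (Ext.mk₀ a) (add_zero 1))
        (Ext.mapExactFunctor_extClass L hS)).symm.trans h)
  exact ⟨adj.homEquiv _ _ k, by rw [← adj.homEquiv_naturality_left, hk]⟩

lemma eq_zero_of_mk₀_comp_eq_zero {A B N : C} (z : A ⟶ B) [IsIso z] {n : ℕ} (e : Ext.{w} B N n)
    (h : (Ext.mk₀ z).comp e (zero_add n) = 0) : e = 0 := by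
  rw [← Ext.mk₀_id_comp e, ← IsIso.inv_hom_id z, ← Ext.mk₀_comp_mk₀_assoc, h, Ext.comp_zero]

end Ext

instance isIso_constComparison (f : X ⟶ Y) : IsIso (constComparison f) := by
  rw [isIso_iff_coyoneda_map_bijective]
  intro G
  let adjX := constantSheafAdj (Opens.grothendieckTopology X) AddCommGrpCat.{u}
    (isTerminalTop : IsTerminal (⊤ : X.Opens))
  let adjY := constantSheafAdj (Opens.grothendieckTopology Y) AddCommGrpCat.{u}
    (isTerminalTop : IsTerminal (⊤ : Y.Opens))
  have homEquiv_comp (k : (inverseImage f).obj (constantZ Y) ⟶ G) :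
      adjX.homEquiv _ _ (constComparison f ≫ k) =
        adjY.homEquiv _ _ ((inverseImageAdj f).homEquiv _ _ k) := by
    refine (adjX.homEquiv_naturality_right (constComparison f) k).trans ?_
    refine (congrArg (· ≫ _) ((adjX.homEquiv _ _).apply_symm_apply _)).trans ?_
    refine Eq.trans ?_ (congrArg _ ((inverseImageAdj f).homEquiv_unit ..).symm)
    exact (adjY.homEquiv_naturality_right ((inverseImageAdj f).unit.app (constantZ Y))
      ((directImage f).map k)).symm
  have comp_eq : (fun k : (inverseImage f).obj (constantZ Y) ⟶ G ↦ constComparison f ≫ k) =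
      (adjX.homEquiv _ _).symm ∘ adjY.homEquiv _ _ ∘ (inverseImageAdj f).homEquiv _ _ :=
    funext fun k ↦ ((adjX.homEquiv _ _).symm_apply_eq.2 (homEquiv_comp k).symm).symm
  rw [comp_eq]
  exact (Equiv.bijective _).comp ((Equiv.bijective _).comp (Equiv.bijective _))

/-! ### Splitting of an extension after pull-back -/

/-- The canonical morphism `M ⟶ f_* f^* M` of abelian sheaves. -/
def unitAb (f : X ⟶ Y) (M : Y.Modules) :
    toAbSheaf M ⟶ (directImage f).obj (toAbSheaf ((Scheme.Modules.pullback f).obj M)) :=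
  ⟨((Scheme.Modules.pullbackPushforwardAdjunction f).unit.app M).mapPresheaf⟩

/-- The extension with inclusion `i : M ⟶ E` splits after pulling it back along `f` and pushing it
out along `f⁻¹ M ⟶ f^* M`. This is stated on the other side of the adjunction between `f⁻¹` and
`f_*`: the unit `M ⟶ f_* f^* M` extends along `i`. -/
def SplitsAfterPullback (f : X ⟶ Y) {M : Y.Modules} {E : AbSheaf Y} (i : toAbSheaf M ⟶ E) : Prop :=
  ∃ h : E ⟶ (directImage f).obj (toAbSheaf ((Scheme.Modules.pullback f).obj M)), i ≫ h = unitAb f M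

lemma splitsAfterPullback_of_cohomologyPullback_eq_zero (f : X ⟶ Y) (M : Y.Modules)
    {E : AbSheaf Y} (i : toAbSheaf M ⟶ E) (q : E ⟶ constantZ Y) (hz : i ≫ q = 0)
    (hS : (ShortComplex.mk i q hz).ShortExact)
    (h : cohomologyPullback f M 1 hS.extClass = 0) : SplitsAfterPullback f i := by
  have h' : ((Ext.mk₀ (constComparison f)).comp (hS.extClass.mapExactFunctor (inverseImage f))
      (zero_add 1)).comp (Ext.mk₀ (inverseImageToPullback f M)) (add_zero 1) = 0 := h
  rw [Ext.comp_assoc_of_third_deg_zero] at h'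
  obtain ⟨k, hk⟩ := exists_adjoint_extension_of_mapExt_eq_zero (inverseImageAdj f) hS
    (inverseImageToPullback f M) (eq_zero_of_mk₀_comp_eq_zero _ _ h')
  exact ⟨k, hk.trans ((inverseImageAdj f).homEquiv _ _ |>.apply_symm_apply _)⟩

/-- The morphism of abelian sheaves underlying a morphism of sheaves of modules. -/
def mapAb {M N : X.Modules} (a : M ⟶ N) : toAbSheaf M ⟶ toAbSheaf N := ⟨a.mapPresheaf⟩

lemma mapAb_id (M : X.Modules) : mapAb (𝟙 M) = 𝟙 _ := rfl

lemma mapAb_comp {M N K : X.Modules} (a : M ⟶ N) (b : N ⟶ K) :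
    mapAb (a ≫ b) = mapAb a ≫ mapAb b := rfl

lemma unit_comp_pullbackComp_inv (f : X ⟶ Y) (g : Y ⟶ Z) (M : Z.Modules) :
    (Scheme.Modules.pullbackPushforwardAdjunction (f ≫ g)).unit.app M ≫
      (Scheme.Modules.pushforward (f ≫ g)).map ((Scheme.Modules.pullbackComp f g).inv.app M) =
    ((Scheme.Modules.pullbackPushforwardAdjunction g).unit.app M ≫
      (Scheme.Modules.pushforward g).map ((Scheme.Modules.pullbackPushforwardAdjunction f).unit.app
        ((Scheme.Modules.pullback g).obj M))) ≫ (Scheme.Modules.pushforwardComp f g).hom.app _ := by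
  have h := unit_conjugateEquiv
    ((Scheme.Modules.pullbackPushforwardAdjunction g).comp
      (Scheme.Modules.pullbackPushforwardAdjunction f))
    (Scheme.Modules.pullbackPushforwardAdjunction (f ≫ g))
    (Scheme.Modules.pullbackComp f g).inv M
  rw [Scheme.Modules.conjugateEquiv_pullbackComp_inv] at h
  exact h.symm

lemma unitAb_comp (f : X ⟶ Y) (g : Y ⟶ Z) (M : Z.Modules) :
    unitAb (f ≫ g) M ≫
      (directImage (f ≫ g)).map (mapAb ((Scheme.Modules.pullbackComp f g).inv.app M)) =
    (unitAb g M ≫ (directImage g).map (unitAb f ((Scheme.Modules.pullback g).obj M)) :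
      toAbSheaf M ⟶ (directImage g).obj ((directImage f).obj _)) := by
  refine (congrArg mapAb (unit_comp_pullbackComp_inv f g M)).trans ?_
  ext U
  rfl

lemma splitsAfterPullback_comp_iff (f : X ⟶ Y) (g : Y ⟶ Z) {M : Z.Modules} {E : AbSheaf Z}
    (i : toAbSheaf M ⟶ E) : SplitsAfterPullback (f ≫ g) i ↔
      ∃ h : E ⟶ (directImage g).obj ((directImage f).obj (toAbSheaf
        ((Scheme.Modules.pullback f).obj ((Scheme.Modules.pullback g).obj M)))),
        i ≫ h =
          unitAb g M ≫ (directImage g).map (unitAb f ((Scheme.Modules.pullback g).obj M)) := by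
  constructor
  · rintro ⟨h, hh⟩
    refine ⟨h ≫ (directImage (f ≫ g)).map (mapAb ((Scheme.Modules.pullbackComp f g).inv.app M)), ?_⟩
    rw [← unitAb_comp, ← hh]
    exact (Category.assoc _ _ _).symm
  · rintro ⟨h, hh⟩
    refine ⟨h ≫ (directImage (f ≫ g)).map (mapAb ((Scheme.Modules.pullbackComp f g).hom.app M)), ?_⟩
    have inv_hom :
        (directImage (f ≫ g)).map (mapAb ((Scheme.Modules.pullbackComp f g).inv.app M)) ≫
          (directImage (f ≫ g)).map (mapAb ((Scheme.Modules.pullbackComp f g).hom.app M)) =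
        𝟙 _ := by
      rw [← Functor.map_comp, ← mapAb_comp, Iso.inv_hom_id_app, mapAb_id,
        CategoryTheory.Functor.map_id]
    refine (Category.assoc _ _ _).symm.trans ((congrArg (· ≫ _) hh).trans ?_)
    refine (congrArg (· ≫ _) (unitAb_comp f g M).symm).trans ?_
    exact (Category.assoc _ _ _).trans ((congrArg (_ ≫ ·) inv_hom).trans (Category.comp_id _))

lemma SplitsAfterPullback.comp (f : X ⟶ Y) {g : Y ⟶ Z} {M : Z.Modules} {E : AbSheaf Z}
    {i : toAbSheaf M ⟶ E} (hg : SplitsAfterPullback g i) : SplitsAfterPullback (f ≫ g) i := by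
  obtain ⟨h, hh⟩ := hg
  rw [splitsAfterPullback_comp_iff]
  exact ⟨h ≫ (directImage g).map (unitAb f _), by rw [← hh, Category.assoc]⟩

lemma SplitsAfterPullback.exists_retraction {M : X.Modules} {E : AbSheaf X} {i : toAbSheaf M ⟶ E}
    (h : SplitsAfterPullback (𝟙 X) i) : ∃ r, i ≫ r = 𝟙 _ := by
  obtain ⟨h, hh⟩ := h
  refine ⟨h ≫ (directImage (𝟙 X)).map (mapAb ((Scheme.Modules.pullbackId X).hom.app M)), ?_⟩
  have unit_comp := unit_conjugateEquiv Adjunction.id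
    (Scheme.Modules.pullbackPushforwardAdjunction (𝟙 X)) (Scheme.Modules.pullbackId X).hom M
  rw [Scheme.Modules.conjugateEquiv_pullbackId_hom] at unit_comp
  refine (Category.assoc _ _ _).symm.trans ((congrArg (· ≫ _) hh).trans ?_)
  refine (congrArg mapAb unit_comp.symm).trans ?_
  ext U
  rfl

/-! ### Restriction of sections -/

/-- Restriction of functions. -/
def resFun {U V : X.Opens} (h : V ≤ U) : Γ(X, U) →+* Γ(X, V) := (X.presheaf.map (homOfLE h).op).hom

/-- Restriction of sections of a sheaf of modules. -/
def resSec (M : X.Modules) {U V : X.Opens} (h : V ≤ U) : Γ(M, U) →ₛₗ[resFun h] Γ(M, V) :=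
  restrictₛₗ M (homOfLE h)

lemma resFun_resFun {U V W : X.Opens} (h : V ≤ U) (h' : W ≤ V) (a : Γ(X, U)) :
    resFun h' (resFun h a) = resFun (h'.trans h) a :=
  (ConcreteCategory.congr_hom (X.presheaf.map_comp (homOfLE h).op (homOfLE h').op) a).symm

lemma resFun_self {U : X.Opens} (a : Γ(X, U)) : resFun le_rfl a = a :=
  ConcreteCategory.congr_hom (X.presheaf.map_id (op U)) a

lemma resSec_resSec (M : X.Modules) {U V W : X.Opens} (h : V ≤ U) (h' : W ≤ V) (a : Γ(M, U)) :
    resSec M h' (resSec M h a) = resSec M (h'.trans h) a :=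
  (ConcreteCategory.congr_hom (M.presheaf.map_comp (homOfLE h).op (homOfLE h').op) a).symm

lemma resSec_self (M : X.Modules) {U : X.Opens} (a : Γ(M, U)) : resSec M le_rfl a = a :=
  ConcreteCategory.congr_hom (M.presheaf.map_id (op U)) a

lemma app_resSec {M N : X.Modules} (a : M ⟶ N) {U V : X.Opens} (h : V ≤ U) (m : Γ(M, U)) :
    a.app V (resSec M h m) = resSec N h (a.app U m) :=
  ConcreteCategory.congr_hom (a.mapPresheaf.naturality (homOfLE h).op) m

/-! ### Bases of sheaves of modules -/

section Basis

variable (M : X.Modules) {ι : Type*} [Fintype ι] {U : X.Opens} (e : ι → Γ(M, U))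

/-- The linear combinations of the restrictions of sections `e i`. -/
def combination {W : X.Opens} (h : W ≤ U) : (ι → Γ(X, W)) →ₗ[Γ(X, W)] Γ(M, W) :=
  Fintype.linearCombination Γ(X, W) (fun i ↦ resSec M h (e i))

lemma combination_apply {W : X.Opens} (h : W ≤ U) (a : ι → Γ(X, W)) :
    combination M e h a = ∑ i, a i • resSec M h (e i) := rfl

lemma resSec_combination {W W' : X.Opens} (h : W ≤ U) (h' : W' ≤ W) (a : ι → Γ(X, W)) :
    resSec M h' (combination M e h a) = combination M e (h'.trans h) (fun i ↦ resFun h' (a i)) := by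
  simp only [combination_apply, map_sum, map_smulₛₗ, resSec_resSec]

/-- The sections `e i` of `M` over `U` form a basis of the restriction of `M` to `U`. -/
def IsBasisOn : Prop :=
  ∀ (W : X.Opens) (h : W ≤ U), Function.Bijective (combination M e h)

variable {M e} (he : IsBasisOn M e)

/-- The coefficients of a section with respect to a basis. -/
def IsBasisOn.coeff {W : X.Opens} (h : W ≤ U) : Γ(M, W) →ₗ[Γ(X, W)] (ι → Γ(X, W)) :=
  (LinearEquiv.ofBijective _ (he W h)).symm

lemma IsBasisOn.combination_coeff {W : X.Opens} (h : W ≤ U) (m : Γ(M, W)) :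
    combination M e h (he.coeff h m) = m :=
  (LinearEquiv.ofBijective _ (he W h)).apply_symm_apply m

lemma IsBasisOn.coeff_resSec {W W' : X.Opens} (h : W ≤ U) (h' : W' ≤ W) (m : Γ(M, W)) :
    he.coeff (h'.trans h) (resSec M h' m) = fun i ↦ resFun h' (he.coeff h m i) := by
  apply (he W' (h'.trans h)).1
  exact (he.combination_coeff (h'.trans h) _).trans
    ((congrArg _ (he.combination_coeff h m)).symm.trans (resSec_combination M e h h' _))

lemma IsBasisOn.coeff_basis [DecidableEq ι] {W : X.Opens} (h : W ≤ U) (i : ι) :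
    he.coeff h (resSec M h (e i)) = Pi.single i 1 := by
  apply (he W h).1
  rw [he.combination_coeff, combination, Fintype.linearCombination_apply_single, one_smul]

lemma isBasisOn_of_coeff (c : ∀ (W : X.Opens), W ≤ U → Γ(M, W) → ι → Γ(X, W))
    (h₁ : ∀ W h a, c W h (combination M e h a) = a)
    (h₂ : ∀ W h m, combination M e h (c W h m) = m) : IsBasisOn M e :=
  fun W h ↦ ⟨Function.LeftInverse.injective (h₁ W h), Function.RightInverse.surjective (h₂ W h)⟩

include he in
lemma IsBasisOn.reindex {κ : Type*} [Fintype κ] (E : κ ≃ ι) : IsBasisOn M (e ∘ E) := by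
  have combination_comp (W : X.Opens) (h : W ≤ U) :
      ⇑(combination M (e ∘ E) h) = combination M e h ∘ E.arrowCongr (Equiv.refl _) :=
    funext fun a ↦ Fintype.sum_equiv E _ _ fun k ↦ by
      simp only [Function.comp_apply, Equiv.arrowCongr_apply, Equiv.symm_apply_apply,
        Equiv.refl_apply]
  intro W h
  rw [combination_comp]
  exact (he W h).comp (Equiv.bijective _)

end Basis

section Dual

variable {M : X.Modules} {ι : Type*} [Fintype ι] {U : X.Opens} {e : ι → Γ(M, U)}
  (he : IsBasisOn M e)

/-- The dual basis. -/
def IsBasisOn.dualBasis (i : ι) : Γ(dual M, U) :=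
  (⟨fun W ↦ LinearMap.proj i ∘ₗ he.coeff W.2, fun _ _ h₁₂ h₂ m ↦
    congrFun (he.coeff_resSec h₂ h₁₂ m) i⟩ : dualSections M U)

lemma IsBasisOn.dual : IsBasisOn (dual M) he.dualBasis := by
  classical
  have combination_dualBasis (W : X.Opens) (h : W ≤ U) (a : ι → Γ(X, W)) (W' : X.Opens)
      (h' : W' ≤ W) (m : Γ(M, W')) :
      (combination (FrobeniusPullback.dual M) he.dualBasis h a : dualSections M W).1 ⟨W', h'⟩ m =
        ∑ i, resFun h' (a i) * he.coeff (h'.trans h) m i := by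
    let evalAt : dualSections M W →+ Γ(X, W') :=
      { toFun := fun φ ↦ φ.1 ⟨W', h'⟩ m
        map_zero' := rfl
        map_add' := fun _ _ ↦ rfl }
    exact map_sum evalAt _ _
  refine isBasisOn_of_coeff (fun W h φ i ↦ (φ : dualSections M W).1 ⟨W, le_rfl⟩ (resSec M h (e i)))
    (fun W h a ↦ ?_) (fun W h φ ↦ ?_)
  · funext i
    rw [combination_dualBasis W h a W le_rfl, Finset.sum_eq_single i]
    · rw [resFun_self, he.coeff_basis, Pi.single_eq_same, mul_one]
    · intro j _ hj
      rw [he.coeff_basis, Pi.single_eq_of_ne hj, mul_zero]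
    · simp
  · refine Subtype.ext (funext fun ⟨W', h'⟩ ↦ LinearMap.ext fun m ↦ ?_)
    refine (combination_dualBasis W h _ W' h' m).trans ?_
    have hφ := fun i ↦ (φ : dualSections M W).2 W' W h' le_rfl (resSec M h (e i))
    conv_rhs => rw [← he.combination_coeff (h'.trans h) m, combination_apply, map_sum]
    refine Finset.sum_congr rfl fun i _ ↦ ?_
    rw [map_smul, smul_eq_mul, mul_comm, ← resSec_resSec M h h']
    exact congrArg _ (hφ i).symm

end Dual

/-- `M` is locally free of finite rank. -/
def IsLocallyFree (M : X.Modules) : Prop :=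
  ∀ x : X, ∃ (U : X.Opens) (_ : x ∈ U) (n : ℕ) (e : Fin n → Γ(M, U)), IsBasisOn M e

section Free

universe v₁ u₁
variable {C : Type u₁} [Category.{v₁} C] {J : GrothendieckTopology C}
  {R : Sheaf J RingCat.{u}} [HasSheafify J AddCommGrpCat.{u}]
  [J.WEqualsLocallyBijective AddCommGrpCat.{u}]

open SheafOfModules in
lemma free_hom_ext {I : Type u} {N : SheafOfModules.{u} R} {a b : free I ⟶ N}
    (h : ∀ i, ιFree i ≫ a = ιFree i ≫ b) : a = b :=
  Cofan.IsColimit.hom_ext (isColimitFreeCofan I) _ _ h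

open SheafOfModules in
lemma exists_basis_of_iso_free {I : Type u} [Fintype I] [DecidableEq I] {N : SheafOfModules.{u} R}
    (f : free I ⟶ N) [IsIso f] :
    ∃ (e : I → (unit R ⟶ N)) (c : I → (N ⟶ unit R)),
      (∀ i j, e i ≫ c j = if i = j then 𝟙 _ else 0) ∧ ∑ i, c i ≫ e i = 𝟙 N := by
  let p (j : I) : free I ⟶ unit R :=
    Cofan.IsColimit.desc (isColimitFreeCofan I) (fun i ↦ if i = j then 𝟙 _ else 0)
  have hp (i j : I) : ιFree i ≫ p j = if i = j then 𝟙 _ else 0 :=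
    Cofan.IsColimit.fac (isColimitFreeCofan I) _ i
  refine ⟨fun i ↦ ιFree i ≫ f, fun j ↦ inv f ≫ p j, fun i j ↦ ?_, ?_⟩
  · rw [Category.assoc, IsIso.hom_inv_id_assoc, hp]
  · rw [← cancel_epi f, ← cancel_mono (inv f)]
    refine free_hom_ext fun i ↦ ?_
    simp only [Preadditive.comp_sum, Preadditive.sum_comp, Category.assoc,
      IsIso.hom_inv_id_assoc, IsIso.hom_inv_id, Category.comp_id]
    simp only [← Category.assoc, hp]
    rw [Finset.sum_eq_single i]
    · rw [if_pos rfl, Category.id_comp]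
    · intro j _ hj
      rw [if_neg hj.symm, zero_comp]
    · exact fun hi ↦ (hi (Finset.mem_univ i)).elim

end Free

lemma isBasisOn_of_unit_hom {M : X.Modules} {U : X.Opens} {I : Type u} [Fintype I] [DecidableEq I]
    (e : I → (SheafOfModules.unit (X.ringCatSheaf.over U) ⟶ M.over U))
    (c : I → (M.over U ⟶ SheafOfModules.unit (X.ringCatSheaf.over U)))
    (hec : ∀ i j, e i ≫ c j = if i = j then 𝟙 _ else 0) (hce : ∑ i, c i ≫ e i = 𝟙 _) :
    IsBasisOn (U := U) M fun i ↦ (e i).val.app (op (Over.mk (𝟙 U))) (1 : Γ(X, U)) := by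
  set b : I → Γ(M, U) := fun i ↦ (e i).val.app (op (Over.mk (𝟙 U))) (1 : Γ(X, U))
  have app_e (W : X.Opens) (h : W ≤ U) (i : I) (a : Γ(X, W)) :
      (e i).val.app (op (Over.mk (homOfLE h))) a = (a • resSec M h (b i) : Γ(M, W)) := by
    have app_one : (e i).val.app (op (Over.mk (homOfLE h))) (1 : Γ(X, W)) = resSec M h (b i) :=
      (congrArg _ (map_one (resFun h)).symm).trans (PresheafOfModules.naturality_apply (e i).val
        (Over.homMk (homOfLE h) : Over.mk (homOfLE h) ⟶ Over.mk (𝟙 U)).op (1 : Γ(X, U)))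
    rw [← app_one]
    exact (congrArg _ (mul_one a).symm).trans
      (((e i).val.app (op (Over.mk (homOfLE h)))).hom.map_smul a (1 : Γ(X, W)))
  refine isBasisOn_of_coeff (fun W h m j ↦ (c j).val.app (op (Over.mk (homOfLE h))) m)
    (fun W h a ↦ funext fun j ↦ ?_) (fun W h m ↦ ?_)
  · have app_comp (i : I) := congrArg
      (fun k ↦ (k.val.app (op (Over.mk (homOfLE h)))).hom (a i)) (hec i j)
    have app_sum : (c j).val.app (op (Over.mk (homOfLE h))) (combination M b h a) =
        ∑ i, (c j).val.app (op (Over.mk (homOfLE h))) (a i • resSec M h (b i) : Γ(M, W)) :=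
      map_sum ((c j).val.app (op (Over.mk (homOfLE h)))).hom _ _
    refine app_sum.trans ?_
    rw [Finset.sum_eq_single j]
    · rw [← app_e]
      exact (app_comp j).trans (by rw [if_pos rfl]; rfl)
    · intro i _ hij
      rw [← app_e]
      exact (app_comp i).trans (by rw [if_neg hij]; rfl)
    · exact fun hj ↦ (hj (Finset.mem_univ j)).elim
  · let evalAt : (M.over U ⟶ M.over U) →+ Γ(M, W) :=
      { toFun := fun k ↦ (k.val.app (op (Over.mk (homOfLE h)))).hom m
        map_zero' := rfl
        map_add' := fun _ _ ↦ rfl }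
    exact (Finset.sum_congr rfl fun i _ ↦ (app_e W h i _).symm).trans
      ((map_sum evalAt _ _).symm.trans (congrArg evalAt hce))

lemma IsVectorBundle.isLocallyFree {M : X.Modules} (hM : IsVectorBundle M) : IsLocallyFree M := by
  obtain ⟨q, h₁, h₂⟩ := hM
  intro x
  obtain ⟨V, f, ⟨i, ⟨hi⟩⟩, hx⟩ := q.coversTop ⊤ x trivial
  have := h₂.isFiniteType i
  have := h₁.isIso i
  have := Fintype.ofFinite (q.generators i).I
  classical
  obtain ⟨e, c, hec, hce⟩ := exists_basis_of_iso_free (q.generators i).π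
  exact ⟨q.X i, hi.le hx, _, _,
    (isBasisOn_of_unit_hom e c hec hce).reindex (Fintype.equivFin (q.generators i).I).symm⟩

lemma IsLocallyFree.dual {M : X.Modules} (hM : IsLocallyFree M) : IsLocallyFree (dual M) :=
  fun x ↦ let ⟨U, hx, n, _, he⟩ := hM x; ⟨U, hx, n, _, he.dual⟩

/-! ### Constructing sheaves of modules and morphisms from sections -/

/-- A sheaf of `𝒪_X`-modules presented by its modules of sections and restriction maps, from which
`ModuleData.toModules` builds an object of `X.Modules`. -/
structure ModuleData (X : Scheme.{u}) where
  sec : X.Opens → Type u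
  [addCommGroup : ∀ U, AddCommGroup (sec U)]
  [module : ∀ U, Module Γ(X, U) (sec U)]
  res {U V : X.Opens} (h : V ≤ U) : sec U →+ sec V
  res_self {U : X.Opens} (s : sec U) : res le_rfl s = s
  res_res {U V W : X.Opens} (h : V ≤ U) (h' : W ≤ V) (s : sec U) :
    res h' (res h s) = res (h'.trans h) s
  res_smul {U V : X.Opens} (h : V ≤ U) (a : Γ(X, U)) (s : sec U) :
    res h (a • s) = resFun h a • res h s
  existsUnique_glue {ι : Type u} (U : ι → X.Opens) (s : ∀ i, sec (U i))
    (hs : ∀ i j, res (inf_le_left : U i ⊓ U j ≤ U i) (s i) = res inf_le_right (s j)) :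
    ∃! t : sec (iSup U), ∀ i, res (le_iSup U i) t = s i

namespace ModuleData

attribute [instance] addCommGroup module

variable (T : ModuleData X)

/-- The underlying abelian presheaf. -/
def ab : TopCat.Presheaf Ab.{u} X where
  obj U := AddCommGrpCat.of (T.sec U.unop)
  map f := AddCommGrpCat.ofHom (T.res f.unop.le)
  map_id U := by
    ext s
    exact T.res_self s
  map_comp f g := by
    ext s
    exact (T.res_res f.unop.le g.unop.le s).symm

instance (U : X.Opensᵒᵖ) : Module (X.ringCatSheaf.obj.obj U) (T.ab.obj U) :=
  inferInstanceAs (Module Γ(X, U.unop) (T.sec U.unop))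

/-- The sheaf of modules associated with the data of its sections. -/
def toModules : X.Modules where
  val := PresheafOfModules.ofPresheaf (R := X.ringCatSheaf.obj) T.ab
    (fun _ _ f a s ↦ T.res_smul f.unop.le a s)
  isSheaf := by
    change T.ab.IsSheaf
    rw [TopCat.Presheaf.isSheaf_iff_isSheafUniqueGluing]
    exact fun _ U s hs ↦ T.existsUnique_glue U s hs

end ModuleData

/-- A morphism of sheaves of modules from its action on sections. -/
def homMk {M N : X.Modules} (a : ∀ U : X.Opens, Γ(M, U) →ₗ[Γ(X, U)] Γ(N, U))
    (ha : ∀ (U V : X.Opens) (h : V ≤ U) (m : Γ(M, U)), a V (resSec M h m) = resSec N h (a U m)) :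
    M ⟶ N :=
  ⟨{ app := fun U ↦ ModuleCat.ofHom (a U.unop)
     naturality := fun f ↦ by
       ext m
       exact ha _ _ f.unop.le m }⟩

section Pullback

variable (f : X ⟶ Y) (M : Y.Modules)

/-- The pull-back of sections `Γ(M, W) → Γ(f^* M, f⁻¹ W)`. -/
def pullbackSec (W : Y.Opens) :
    Γ(M, W) →ₛₗ[(f.app W).hom] Γ((Scheme.Modules.pullback f).obj M, f ⁻¹ᵁ W) where
  toFun m := ((Scheme.Modules.pullbackPushforwardAdjunction f).unit.app M).app W m
  map_add' := map_add _
  map_smul' a m := Scheme.Modules.Hom.app_smul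
    ((Scheme.Modules.pullbackPushforwardAdjunction f).unit.app M) a m

lemma resFun_app {W W' : Y.Opens} (h : W' ≤ W) (a : Γ(Y, W)) :
    resFun (f.preimage_mono h) (f.app W a) = f.app W' (resFun h a) :=
  (ConcreteCategory.congr_hom (f.naturality (homOfLE h).op) a).symm

lemma pullbackSec_resSec {W W' : Y.Opens} (h : W' ≤ W) (m : Γ(M, W)) :
    pullbackSec f M W' (resSec M h m) = resSec _ (f.preimage_mono h) (pullbackSec f M W m) :=
  app_resSec ((Scheme.Modules.pullbackPushforwardAdjunction f).unit.app M) h m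

variable {M}

lemma pullback_hom_ext {N : X.Modules} {a b : (Scheme.Modules.pullback f).obj M ⟶ N}
    (h : ∀ W m, a.app (f ⁻¹ᵁ W) (pullbackSec f M W m) = b.app (f ⁻¹ᵁ W) (pullbackSec f M W m)) :
    a = b := by
  apply ((Scheme.Modules.pullbackPushforwardAdjunction f).homEquiv _ _).injective
  rw [Adjunction.homEquiv_unit, Adjunction.homEquiv_unit]
  refine Scheme.Modules.hom_ext _ _ fun W ↦ ?_
  ext m
  exact h W m

lemma exists_pullback_hom {N : X.Modules}
    (t : ∀ W : Y.Opens, Γ(M, W) →ₛₗ[(f.app W).hom] Γ(N, f ⁻¹ᵁ W))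
    (ht : ∀ (W W' : Y.Opens) (h : W' ≤ W) (m : Γ(M, W)),
      t W' (resSec M h m) = resSec N (f.preimage_mono h) (t W m)) :
    ∃ a : (Scheme.Modules.pullback f).obj M ⟶ N,
      ∀ W m, a.app (f ⁻¹ᵁ W) (pullbackSec f M W m) = t W m := by
  let τ : M ⟶ (Scheme.Modules.pushforward f).obj N :=
    homMk (fun W ↦
      { toFun := t W
        map_add' := map_add _
        map_smul' := fun a m ↦ (t W).map_smulₛₗ a m }) ht
  refine ⟨((Scheme.Modules.pullbackPushforwardAdjunction f).homEquiv _ _).symm τ, fun W m ↦ ?_⟩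
  have unit_comp :=
    ((Scheme.Modules.pullbackPushforwardAdjunction f).homEquiv M N).apply_symm_apply τ
  rw [Adjunction.homEquiv_unit] at unit_comp
  exact congrArg (fun k ↦ (Scheme.Modules.Hom.app k W) m) unit_comp

end Pullback

/-! ### Local freeness of pull-backs -/

lemma existsUnique_glue (N : X.Modules) {ι : Type u} (U : ι → X.Opens) (V : X.Opens)
    (hU : ∀ i, U i ≤ V) (hV : V ≤ iSup U) (s : ∀ i, Γ(N, U i))
    (hs : ∀ i j, resSec N (inf_le_left : U i ⊓ U j ≤ U i) (s i) = resSec N inf_le_right (s j)) :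
    ∃! t : Γ(N, V), ∀ i, resSec N (hU i) t = s i :=
  TopCat.Sheaf.existsUnique_gluing' ⟨N.presheaf, N.isSheaf⟩ U V (fun i ↦ homOfLE (hU i)) hV s hs

lemma eq_of_locally_eq (N : X.Modules) {ι : Type u} (U : ι → X.Opens) (V : X.Opens)
    (hU : ∀ i, U i ≤ V) (hV : V ≤ iSup U) (s t : Γ(N, V))
    (h : ∀ i, resSec N (hU i) s = resSec N (hU i) t) : s = t :=
  TopCat.Sheaf.eq_of_locally_eq' ⟨N.presheaf, N.isSheaf⟩ U V (fun i ↦ homOfLE (hU i)) hV s t h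

/-- The sections `W ↦ N(W ∩ V)` of the sheaf `localize V N`. -/
def localizeData (V : X.Opens) (N : X.Modules) : ModuleData X where
  sec W := Γ(N, W ⊓ V)
  module W := Module.compHom _ (resFun (inf_le_left : W ⊓ V ≤ W))
  res h := (resSec N (inf_le_inf_right V h)).toAddMonoidHom
  res_self s := resSec_self N s
  res_res h h' s := resSec_resSec N _ _ s
  res_smul {U W} h a s := by
    refine ((resSec N (inf_le_inf_right V h)).map_smulₛₗ (resFun inf_le_left a) s).trans ?_
    refine congrArg (· • resSec N (inf_le_inf_right V h) s) ?_
    exact (resFun_resFun _ _ _).trans (resFun_resFun h (inf_le_left : W ⊓ V ≤ W) a).symm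
  existsUnique_glue {ι} U s hs := by
    refine existsUnique_glue N (fun i ↦ U i ⊓ V) (iSup U ⊓ V)
      (fun i ↦ inf_le_inf_right V (le_iSup U i)) (by rw [iSup_inf_eq]) s fun i j ↦ ?_
    have inf_le : U i ⊓ V ⊓ (U j ⊓ V) ≤ U i ⊓ U j ⊓ V :=
      le_inf (inf_le_inf inf_le_left inf_le_left) (inf_le_left.trans inf_le_right)
    exact (resSec_resSec N _ _ _).symm.trans
      ((congrArg (resSec N inf_le) (hs i j)).trans (resSec_resSec N _ _ _))

/-- The direct image on `X` of the restriction of `N` to the open set `V`, i.e. the sheaf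
`W ↦ N(W ∩ V)`. Sections of `N` over `V` act on it, so local constructions over `V` can be made with
morphisms defined on all of `X`. -/
def localize (V : X.Opens) (N : X.Modules) : X.Modules := (localizeData V N).toModules

/-- The identification of the sections of `localize V N` with those of `N`. -/
def localizeEquiv (V : X.Opens) (N : X.Modules) (W : X.Opens) :
    Γ(localize V N, W) ≃+ Γ(N, W ⊓ V) :=
  AddEquiv.refl _

lemma localizeEquiv_smul (V : X.Opens) (N : X.Modules) (W : X.Opens) (a : Γ(X, W))
    (s : Γ(localize V N, W)) : localizeEquiv V N W (a • s) =
      resFun (inf_le_left : W ⊓ V ≤ W) a • localizeEquiv V N W s := rfl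

/-- The structure sheaf as a sheaf of modules over itself. -/
def structureSheaf (X : Scheme.{u}) : X.Modules := SheafOfModules.unit X.ringCatSheaf

/-- `localizeEquiv` for the structure sheaf, with sections regarded as functions. -/
def localizeFunEquiv (V W : X.Opens) : Γ(localize V (structureSheaf X), W) ≃+ Γ(X, W ⊓ V) :=
  AddEquiv.refl _

lemma localizeFunEquiv_smul (V W : X.Opens) (a : Γ(X, W))
    (s : Γ(localize V (structureSheaf X), W)) :
    localizeFunEquiv V W (a • s) = resFun inf_le_left a * localizeFunEquiv V W s := rfl

lemma localizeFunEquiv_resSec (V : X.Opens) {W W' : X.Opens} (h : W' ≤ W)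
    (s : Γ(localize V (structureSheaf X), W)) :
    localizeFunEquiv V W' (resSec _ h s) =
      resFun (inf_le_inf_right V h) (localizeFunEquiv V W s) := rfl

/-- Restriction to `V` as a morphism `N ⟶ localize V N`. -/
def toLocalize (V : X.Opens) (N : X.Modules) : N ⟶ localize V N :=
  homMk (fun W ↦
    { toFun := fun x ↦ (localizeEquiv V N W).symm (resSec N inf_le_left x)
      map_add' := fun x y ↦ by rw [map_add, map_add]
      map_smul' := fun a x ↦ (resSec N (inf_le_left : W ⊓ V ≤ W)).map_smulₛₗ a x })
    (fun U W h m ↦ (resSec_resSec N _ _ _).trans (resSec_resSec N _ (inf_le_inf_right V h) m).symm)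

/-- The linear combination of given sections over `V` with coefficients in `localize V 𝒪_X`. -/
def localCombination {V : X.Opens} {N P : X.Modules} {ι : Type*} [Fintype ι]
    (ε : ι → (P ⟶ localize V (structureSheaf X))) (s : ι → Γ(N, V)) : P ⟶ localize V N :=
  homMk (fun W ↦
    { toFun := fun x ↦ (localizeEquiv V N W).symm
        (combination N s inf_le_right fun i ↦ localizeFunEquiv V W ((ε i).app W x))
      map_add' := fun x y ↦ by
        rw [← map_add, ← map_add]
        congr 2
        funext i
        rw [map_add, map_add]; rfl
      map_smul' := fun a x ↦ by
        apply (localizeEquiv V N W).injective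
        rw [RingHom.id_apply, localizeEquiv_smul, AddEquiv.apply_symm_apply,
          AddEquiv.apply_symm_apply, ← map_smul]
        congr 1
        funext i
        rw [Scheme.Modules.Hom.app_smul, localizeFunEquiv_smul]; rfl })
    (fun U W h m ↦ by
      change combination N s _ (fun i ↦ localizeFunEquiv V W ((ε i).app W (resSec P h m))) =
        resSec N _ (combination N s _ (fun i ↦ localizeFunEquiv V U ((ε i).app U m)))
      rw [resSec_combination]
      congr 1
      funext i
      rw [app_resSec, localizeFunEquiv_resSec])

section PullbackBasis

variable (f : X ⟶ Y) {M : Y.Modules} {ι : Type*} [Fintype ι] {U : Y.Opens} {e : ι → Γ(M, U)}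
  (he : IsBasisOn M e)

lemma IsBasisOn.exists_pullback_coeff (i : ι) :
    ∃ ε : (Scheme.Modules.pullback f).obj M ⟶ localize (f ⁻¹ᵁ U) (structureSheaf X), ∀ W m,
      ε.app (f ⁻¹ᵁ W) (pullbackSec f M W m) = (localizeFunEquiv (f ⁻¹ᵁ U) (f ⁻¹ᵁ W)).symm
        (f.app (W ⊓ U) (he.coeff inf_le_right (resSec M inf_le_left m) i)) := by
  refine exists_pullback_hom f (N := localize (f ⁻¹ᵁ U) (structureSheaf X)) (fun W ↦
    { toFun := fun m ↦ (localizeFunEquiv (f ⁻¹ᵁ U) (f ⁻¹ᵁ W)).symm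
        ((f.app (W ⊓ U)).hom (he.coeff inf_le_right (resSec M inf_le_left m) i))
      map_add' := fun m m' ↦ ?_
      map_smul' := fun a m ↦ ?_ }) fun W W' h m ↦ ?_
  · have coeff_add : he.coeff inf_le_right (resSec M inf_le_left (m + m')) i =
        he.coeff inf_le_right (resSec M (inf_le_left : W ⊓ U ≤ W) m) i +
          he.coeff inf_le_right (resSec M inf_le_left m') i := by
      rw [map_add, map_add, Pi.add_apply (M := fun _ ↦ Γ(Y, W ⊓ U))]
    exact (congrArg _ coeff_add).trans (map_add (f.app (W ⊓ U)).hom _ _)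
  · have coeff_smul : he.coeff inf_le_right (resSec M inf_le_left (a • m)) i =
        resFun inf_le_left a *
          he.coeff inf_le_right (resSec M (inf_le_left : W ⊓ U ≤ W) m) i := by
      rw [map_smulₛₗ, map_smul, Pi.smul_apply, smul_eq_mul]
    refine (congrArg _ coeff_smul).trans ((map_mul (f.app (W ⊓ U)).hom _ _).trans ?_)
    exact congrArg (· * _) (resFun_app f inf_le_left a).symm
  · have coeff_res :
        he.coeff inf_le_right (resSec M inf_le_left (resSec M h m)) i =
          resFun (inf_le_inf_right U h) (he.coeff inf_le_right (resSec M inf_le_left m) i) := by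
      rw [resSec_resSec]
      refine Eq.trans ?_
        (congrFun (he.coeff_resSec inf_le_right (inf_le_inf_right U h) (resSec M inf_le_left m)) i)
      rw [resSec_resSec]
    exact (congrArg _ coeff_res).trans (resFun_app f (inf_le_inf_right U h) _).symm

variable {he} {ε : ι → ((Scheme.Modules.pullback f).obj M ⟶ localize (f ⁻¹ᵁ U) (structureSheaf X))}
  (hε : ∀ i W m, (ε i).app (f ⁻¹ᵁ W) (pullbackSec f M W m) =
    (localizeFunEquiv (f ⁻¹ᵁ U) (f ⁻¹ᵁ W)).symm
      (f.app (W ⊓ U) (he.coeff inf_le_right (resSec M inf_le_left m) i)))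

include hε in
lemma toLocalize_pullback_eq_localCombination :
    toLocalize (f ⁻¹ᵁ U) ((Scheme.Modules.pullback f).obj M) =
      localCombination ε (fun i ↦ pullbackSec f M U (e i)) := by
  refine pullback_hom_ext f fun W m ↦ ?_
  apply (localizeEquiv (f ⁻¹ᵁ U) _ _).injective
  change resSec _ _ (pullbackSec f M W m) =
    combination _ _ _ (fun i ↦ localizeFunEquiv _ _ ((ε i).app _ (pullbackSec f M W m)))
  simp only [hε]
  refine (pullbackSec_resSec f M (inf_le_left : W ⊓ U ≤ W) m).symm.trans ?_
  conv_lhs => rw [← he.combination_coeff inf_le_right (resSec M inf_le_left m)]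
  rw [combination_apply, map_sum]
  refine Finset.sum_congr rfl fun i _ ↦ ?_
  rw [map_smulₛₗ, pullbackSec_resSec]
  rfl

include hε in
lemma pullback_coeff_basis [DecidableEq ι] (i j : ι) :
    (ε i).app (f ⁻¹ᵁ U) (pullbackSec f M U (e j)) =
      (localizeFunEquiv (f ⁻¹ᵁ U) (f ⁻¹ᵁ U)).symm (if i = j then 1 else 0) := by
  refine (hε i U (e j)).trans (congrArg _ ?_)
  rw [he.coeff_basis]
  rcases eq_or_ne i j with rfl | h
  · rw [Pi.single_eq_same, if_pos rfl]
    exact map_one _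
  · rw [Pi.single_eq_of_ne h, if_neg h]
    exact map_zero _

include he in
lemma IsBasisOn.pullback :
    IsBasisOn ((Scheme.Modules.pullback f).obj M) (fun i ↦ pullbackSec f M U (e i)) := by
  classical
  choose ε hε using he.exists_pullback_coeff f
  refine isBasisOn_of_coeff
    (fun W h x i ↦ resFun (le_inf le_rfl h) (localizeFunEquiv (f ⁻¹ᵁ U) W ((ε i).app W x)))
    (fun W h a ↦ funext fun i ↦ ?_) (fun W h x ↦ ?_)
  · rw [combination_apply, map_sum, map_sum, map_sum, Finset.sum_eq_single i]
    · rw [Scheme.Modules.Hom.app_smul, localizeFunEquiv_smul, map_mul, resFun_resFun, resFun_self,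
        app_resSec, pullback_coeff_basis f hε, localizeFunEquiv_resSec, AddEquiv.apply_symm_apply,
        if_pos rfl, map_one, map_one, mul_one]
    · intro j _ hj
      rw [Scheme.Modules.Hom.app_smul, localizeFunEquiv_smul, map_mul, app_resSec,
        pullback_coeff_basis f hε, localizeFunEquiv_resSec, AddEquiv.apply_symm_apply,
        if_neg hj.symm, map_zero, map_zero, mul_zero]
    · exact fun hi ↦ (hi (Finset.mem_univ i)).elim
  · have restrict_eq := congrArg
      (fun k ↦ resSec _ (le_inf le_rfl h)
        (localizeEquiv (f ⁻¹ᵁ U) _ W (Scheme.Modules.Hom.app k W x)))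
      (toLocalize_pullback_eq_localCombination f hε)
    refine Eq.trans ?_ (restrict_eq.symm.trans ?_)
    · exact (resSec_combination _ _ inf_le_right (le_inf le_rfl h) _).symm
    · exact (resSec_resSec _ inf_le_left (le_inf le_rfl h) x).trans (resSec_self _ x)

end PullbackBasis

lemma IsLocallyFree.pullback (f : X ⟶ Y) {M : Y.Modules} (hM : IsLocallyFree M) :
    IsLocallyFree ((Scheme.Modules.pullback f).obj M) :=
  fun x ↦ let ⟨U, hx, n, _, he⟩ := hM (f x); ⟨f ⁻¹ᵁ U, hx, n, _, he.pullback f⟩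

/-! ### Sections of associated sheaves -/

section Sheafify

variable (P : X.PresheafOfModules)

instance (W : X.Opens) : Module Γ(X, W) (P.obj (op W)) := (P.obj (op W)).isModule

/-- Restriction of sections of a presheaf of modules. -/
def resPre {U V : X.Opens} (h : V ≤ U) : P.obj (op U) →ₛₗ[resFun h] P.obj (op V) where
  toFun x := P.map (homOfLE h).op x
  map_add' := map_add (P.map (homOfLE h).op).hom
  map_smul' := PresheafOfModules.map_smul P (homOfLE h).op

/-- The section of the associated sheaf defined by a section of a presheaf. -/
def toSheafify (W : X.Opens) : P.obj (op W) →ₗ[Γ(X, W)] Γ(sheafify P, W) where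
  toFun x := ((PresheafOfModules.sheafificationAdjunction
    (𝟙 X.ringCatSheaf.obj)).unit.app P).app (op W) x
  map_add' := map_add (((PresheafOfModules.sheafificationAdjunction
    (𝟙 X.ringCatSheaf.obj)).unit.app P).app (op W)).hom
  map_smul' := (((PresheafOfModules.sheafificationAdjunction
    (𝟙 X.ringCatSheaf.obj)).unit.app P).app (op W)).hom.map_smul

lemma toSheafify_resPre {U V : X.Opens} (h : V ≤ U) (x : P.obj (op U)) :
    toSheafify P V (resPre P h x) = resSec (sheafify P) h (toSheafify P U x) :=
  PresheafOfModules.naturality_apply ((PresheafOfModules.sheafificationAdjunction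
    (𝟙 X.ringCatSheaf.obj)).unit.app P) (homOfLE h).op x

lemma exists_sheafify_hom {N : X.Modules} (g : ∀ W, P.obj (op W) →ₗ[Γ(X, W)] Γ(N, W))
    (hg : ∀ (U V : X.Opens) (h : V ≤ U) (x : P.obj (op U)),
      g V (resPre P h x) = resSec N h (g U x)) :
    ∃ a : sheafify P ⟶ N, ∀ W x, a.app W (toSheafify P W x) = g W x := by
  let γ : P ⟶ (SheafOfModules.forget X.ringCatSheaf ⋙
      PresheafOfModules.restrictScalars (𝟙 X.ringCatSheaf.obj)).obj N :=
    { app := fun W ↦ ModuleCat.ofHom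
        (Y := (PresheafOfModules.restrictScalars (𝟙 X.ringCatSheaf.obj) |>.obj N.val).obj W)
        { toFun := g W.unop
          map_add' := map_add _
          map_smul' := (g W.unop).map_smul }
      naturality := fun f ↦ by
        ext x
        exact hg _ _ f.unop.le x }
  let adj := PresheafOfModules.sheafificationAdjunction (𝟙 X.ringCatSheaf.obj)
  refine ⟨(adj.homEquiv _ _).symm γ, fun W x ↦ ?_⟩
  have unit_comp := (adj.homEquiv_unit P N _).symm.trans ((adj.homEquiv P N).apply_symm_apply γ)
  exact congrArg (fun k ↦ (PresheafOfModules.Hom.app k (op W)) x) unit_comp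

end Sheafify

/-! ### Tensor products -/

section Tensor

variable (M N : X.Modules)

/-- The presheaf `U ↦ M(U) ⊗ N(U)`. -/
def tensorPresheaf : X.PresheafOfModules :=
  PresheafOfModules.Monoidal.tensorObj (R := X.presheaf) M.val N.val

/-- The sections of the presheaf `U ↦ M(U) ⊗ N(U)`. -/
def tensorPresheafEquiv (W : X.Opens) :
    TensorProduct Γ(X, W) Γ(M, W) Γ(N, W) ≃ₗ[Γ(X, W)] (tensorPresheaf M N).obj (op W) where
  toFun x := x
  invFun x := x
  map_add' _ _ := rfl
  map_smul' _ _ := rfl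
  left_inv _ := rfl
  right_inv _ := rfl

/-- The section `m ⊗ n` of the tensor product. -/
def tmulSec (W : X.Opens) : Γ(M, W) →ₗ[Γ(X, W)] Γ(N, W) →ₗ[Γ(X, W)] Γ(tensor M N, W) :=
  (TensorProduct.mk Γ(X, W) Γ(M, W) Γ(N, W)).compr₂
    (toSheafify (tensorPresheaf M N) W ∘ₗ (tensorPresheafEquiv M N W).toLinearMap)

lemma resSec_tmulSec {U V : X.Opens} (h : V ≤ U) (m : Γ(M, U)) (n : Γ(N, U)) :
    resSec _ h (tmulSec M N U m n) = tmulSec M N V (resSec M h m) (resSec N h n) :=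
  (toSheafify_resPre (tensorPresheaf M N) h (tensorPresheafEquiv M N U (m ⊗ₜ n))).symm

variable {M N}

lemma exists_tensor_hom {K : X.Modules}
    (g : ∀ W, Γ(M, W) →ₗ[Γ(X, W)] Γ(N, W) →ₗ[Γ(X, W)] Γ(K, W))
    (hg : ∀ (U V : X.Opens) (h : V ≤ U) (m : Γ(M, U)) (n : Γ(N, U)),
      g V (resSec M h m) (resSec N h n) = resSec K h (g U m n)) :
    ∃ a : tensor M N ⟶ K, ∀ W m n, a.app W (tmulSec M N W m n) = g W m n := by
  obtain ⟨a, ha⟩ := exists_sheafify_hom (tensorPresheaf M N) (N := K)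
    (fun W ↦ TensorProduct.lift (g W) ∘ₗ (tensorPresheafEquiv M N W).symm.toLinearMap)
    (fun U V h x ↦ by
      obtain ⟨x, rfl⟩ := (tensorPresheafEquiv M N U).surjective x
      induction x using TensorProduct.induction_on with
      | zero => simp only [map_zero]
      | add x y hx hy => rw [map_add, map_add, map_add, map_add, map_add, hx, hy]
      | tmul m n => exact hg U V h m n)
  exact ⟨a, fun W m n ↦ ha W (tensorPresheafEquiv M N W (m ⊗ₜ n))⟩

/-- Tensor products of isomorphic presheaves of modules are isomorphic. -/
def tensorObjIso {C : Type*} [Category C] {R : Cᵒᵖ ⥤ CommRingCat.{u}}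
    {M M' : PresheafOfModules.{u} (R ⋙ forget₂ CommRingCat RingCat)} (e : M ≅ M')
    (N : PresheafOfModules.{u} (R ⋙ forget₂ CommRingCat RingCat)) :
    PresheafOfModules.Monoidal.tensorObj M N ≅ PresheafOfModules.Monoidal.tensorObj M' N :=
  MonoidalCategory.whiskerRightIso e N

/-- Tensor products of isomorphic sheaves are isomorphic. -/
def tensorIso {M M' : X.Modules} (e : M ≅ M') (N : X.Modules) : tensor M N ≅ tensor M' N :=
  (PresheafOfModules.sheafification (𝟙 X.ringCatSheaf.obj)).mapIso
    (tensorObjIso (R := X.presheaf) ((SheafOfModules.forget X.ringCatSheaf).mapIso e) N.val)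

end Tensor

/-! ### Differentials -/

section Differentials

variable (f : X ⟶ Y)

/-- The morphism `f⁻¹ 𝒪_Y ⟶ 𝒪_X` of presheaves. -/
abbrev inverseImageRing :
    (TopCat.Presheaf.pullback CommRingCat.{u} f.base).obj Y.presheaf ⟶ X.presheaf :=
  ((TopCat.Presheaf.pullbackPushforwardAdjunction CommRingCat.{u} f.base).homEquiv _ _).symm f.c

/-- The presheaf whose associated sheaf is `Ω_f`. -/
def omegaPresheaf : X.PresheafOfModules :=
  PresheafOfModules.DifferentialsConstruction.relativeDifferentials' (inverseImageRing f)

/-- The universal derivation at the level of presheaves. -/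
def presheafDifferential : PresheafOfModules.Derivation' (R := X.presheaf) (omegaPresheaf f)
    (inverseImageRing f) :=
  PresheafOfModules.DifferentialsConstruction.derivation' (inverseImageRing f)

/-- The universal derivation `𝒪_X → Ω_f`. -/
def differential (W : X.Opens) : Γ(X, W) →+ Γ(relativeDifferentials f, W) :=
  (toSheafify (omegaPresheaf f) W).toAddMonoidHom.comp ((presheafDifferential f).d (X := op W))

lemma differential_mul (W : X.Opens) (a b : Γ(X, W)) :
    differential f W (a * b) = a • differential f W b + b • differential f W a := by
  refine (congrArg (toSheafify (omegaPresheaf f) W)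
    ((presheafDifferential f).d_mul (X := op W) a b)).trans ?_
  refine (map_add (toSheafify (omegaPresheaf f) W) _ _).trans (congrArg₂ _ ?_ ?_)
  all_goals exact (toSheafify (omegaPresheaf f) W).map_smul _ _

lemma differential_one (W : X.Opens) : differential f W 1 = 0 := by
  simpa only [mul_one, one_smul, left_eq_add] using differential_mul f W 1 1

lemma resSec_differential {U V : X.Opens} (h : V ≤ U) (a : Γ(X, U)) :
    resSec _ h (differential f U a) = differential f V (resFun h a) :=
  (toSheafify_resPre (omegaPresheaf f) h _).symm.trans
    (congrArg (toSheafify (omegaPresheaf f) V)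
      ((presheafDifferential f).d_map (homOfLE h).op a).symm)

lemma differential_app (U : Y.Opens) (b : Γ(Y, U)) : differential f (f ⁻¹ᵁ U) (f.app U b) = 0 := by
  let adj := TopCat.Presheaf.pullbackPushforwardAdjunction CommRingCat.{u} f.base
  have unit_comp : adj.unit.app Y.presheaf ≫ _ = f.c :=
    (adj.homEquiv_unit Y.presheaf X.presheaf (inverseImageRing f)).symm.trans
      ((adj.homEquiv _ _).apply_symm_apply f.c)
  have inverseImageRing_unit :
      (inverseImageRing f).app (op (f ⁻¹ᵁ U)) ((adj.unit.app Y.presheaf).app (op U) b) =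
        f.app U b :=
    congrArg (fun k : Y.presheaf ⟶ (TopCat.Presheaf.pushforward CommRingCat f.base).obj X.presheaf ↦
      (k.app (op U)).hom b) unit_comp
  rw [← inverseImageRing_unit]
  exact (congrArg (toSheafify (omegaPresheaf f) (f ⁻¹ᵁ U))
    ((presheafDifferential f).d_app (X := op (f ⁻¹ᵁ U)) _)).trans (map_zero _)

variable {N : X.Modules} (δ : ∀ W : X.Opens, Γ(X, W) →+ Γ(N, W))
    (h_mul : ∀ W a b, δ W (a * b) = a • δ W b + b • δ W a)
    (h_res : ∀ (U V : X.Opens) (h : V ≤ U) a, δ V (resFun h a) = resSec N h (δ U a))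

/-- The functions killed by a derivation. -/
def constantsSubring (W : X.Opens) : Subring Γ(X, W) where
  carrier := {a | δ W a = 0}
  mul_mem' := by
    intro a b (ha : δ W a = 0) (hb : δ W b = 0)
    change δ W (a * b) = 0
    rw [h_mul, ha, hb, smul_zero, smul_zero, add_zero]
  one_mem' := by
    change δ W 1 = 0
    simpa only [mul_one, one_smul, left_eq_add] using h_mul W 1 1
  add_mem' := by
    intro a b (ha : δ W a = 0) (hb : δ W b = 0)
    change δ W (a + b) = 0
    rw [map_add, ha, hb, add_zero]
  zero_mem' := map_zero _
  neg_mem' := by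
    intro a (ha : δ W a = 0)
    change δ W (-a) = 0
    rw [map_neg, ha, neg_zero]

/-- The presheaf of functions killed by a derivation. -/
def constants : TopCat.Presheaf CommRingCat.{u} X where
  obj W := .of (constantsSubring δ h_mul W.unop)
  map {_ V} g := CommRingCat.ofHom (((resFun g.unop.le).comp (Subring.subtype _)).codRestrict
    (constantsSubring δ h_mul V.unop)
    fun a ↦ (h_res _ _ g.unop.le a.1).trans ((congrArg _ a.2).trans (map_zero _)))
  map_id _ := CommRingCat.hom_ext (RingHom.ext fun a ↦ Subtype.ext (resFun_self a.1))
  map_comp g g' := CommRingCat.hom_ext (RingHom.ext fun a ↦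
    Subtype.ext (resFun_resFun g.unop.le g'.unop.le a.1).symm)

include h_mul h_res in
lemma derivation_inverseImageRing
    (h_app : ∀ (U : Y.Opens) (b : Γ(Y, U)), δ (f ⁻¹ᵁ U) (f.app U b) = 0) (W : X.Opens)
    (a : ((TopCat.Presheaf.pullback CommRingCat.{u} f.base).obj Y.presheaf).obj (op W)) :
    δ W ((inverseImageRing f).app (op W) a) = 0 := by
  let K := constants δ h_mul h_res
  let i : K ⟶ X.presheaf :=
    { app := fun W ↦ CommRingCat.ofHom (constantsSubring δ h_mul W.unop).subtype
      naturality := fun _ _ _ ↦ rfl }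
  let c : Y.presheaf ⟶ (TopCat.Presheaf.pushforward CommRingCat f.base).obj K :=
    { app := fun U ↦ CommRingCat.ofHom ((f.app U.unop).hom.codRestrict
        (constantsSubring δ h_mul (f ⁻¹ᵁ U.unop)) (h_app U.unop))
      naturality := fun U V g ↦ by
        ext b
        exact Subtype.ext (ConcreteCategory.congr_hom (f.c.naturality g) b) }
  have hc : c ≫ (TopCat.Presheaf.pushforward CommRingCat f.base).map i = f.c := rfl
  have factors := (TopCat.Presheaf.pullbackPushforwardAdjunction CommRingCat.{u}
    f.base).homEquiv_naturality_right_symm c i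
  rw [hc] at factors
  refine (congrArg (fun k : (TopCat.Presheaf.pullback CommRingCat.{u} f.base).obj Y.presheaf ⟶
    X.presheaf ↦ δ W ((k.app (op W)).hom a)) factors).trans ?_
  exact Subtype.property (p := (· ∈ constantsSubring δ h_mul W)) _

include h_mul h_res in
lemma exists_differentials_hom
    (h_app : ∀ (U : Y.Opens) (b : Γ(Y, U)), δ (f ⁻¹ᵁ U) (f.app U b) = 0) :
    ∃ a : relativeDifferentials f ⟶ N, ∀ W b, a.app W (differential f W b) = δ W b := by
  let d : PresheafOfModules.Derivation' (R := X.presheaf) N.val (inverseImageRing f) :=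
    { d := fun {W} ↦ δ W.unop
      d_mul := fun {W} ↦ h_mul W.unop
      d_map := fun {_ _} g a ↦ h_res _ _ g.unop.le a
      d_app := fun {W} a ↦ derivation_inverseImageRing f δ h_mul h_res h_app W.unop a }
  let univ := PresheafOfModules.DifferentialsConstruction.isUniversal' (inverseImageRing f)
  obtain ⟨a, ha⟩ := exists_sheafify_hom (omegaPresheaf f)
    (N := N) (fun W ↦ ((univ.desc d).app (op W)).hom)
    (fun U V h x ↦ PresheafOfModules.naturality_apply (univ.desc d) (homOfLE h).op x)
  refine ⟨a, fun W b ↦ (ha W _).trans ?_⟩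
  exact PresheafOfModules.Derivation.congr_d (univ.fac d) (X := op W) b

end Differentials

section Connection

variable (f : X ⟶ Y) (P : X.Modules)

/-- The module structure on the sections of `P ⊕ (P ⊗ Ω_f)` over `W` for which a function `a` acts
by `(x, y) ↦ (a x, a y + x ⊗ da)`. -/
abbrev jetModule (W : X.Opens) :
    Module Γ(X, W) (Γ(P, W) × Γ(tensor P (relativeDifferentials f), W)) where
  smul a x := (a • x.1, a • x.2 + tmulSec P _ W x.1 (differential f W a))
  one_smul x := Prod.ext (one_smul _ _) (by
    change (1 : Γ(X, W)) • x.2 + tmulSec P _ W x.1 (differential f W 1) = x.2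
    rw [differential_one, map_zero, one_smul, add_zero])
  mul_smul a b x := Prod.ext (mul_smul _ _ _) (by
    change (a * b) • x.2 + tmulSec P _ W x.1 (differential f W (a * b)) =
      a • (b • x.2 + tmulSec P _ W x.1 (differential f W b)) +
        tmulSec P _ W (b • x.1) (differential f W a)
    rw [differential_mul, map_add, map_smul, map_smul, map_smul, LinearMap.smul_apply, smul_add,
      mul_smul, add_assoc])
  smul_zero a := Prod.ext (smul_zero _) (by
    change a • (0 : Γ(tensor P (relativeDifferentials f), W)) +
      tmulSec P _ W 0 (differential f W a) = 0
    rw [smul_zero, map_zero, LinearMap.zero_apply, add_zero])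
  smul_add a x y := Prod.ext (smul_add _ _ _) (by
    change a • (x.2 + y.2) + tmulSec P _ W (x.1 + y.1) (differential f W a) =
      (a • x.2 + tmulSec P _ W x.1 (differential f W a)) +
        (a • y.2 + tmulSec P _ W y.1 (differential f W a))
    rw [smul_add, map_add, LinearMap.add_apply, add_add_add_comm])
  add_smul a b x := Prod.ext (add_smul _ _ _) (by
    change (a + b) • x.2 + tmulSec P _ W x.1 (differential f W (a + b)) =
      (a • x.2 + tmulSec P _ W x.1 (differential f W a)) +
        (b • x.2 + tmulSec P _ W x.1 (differential f W b))
    rw [add_smul, map_add, map_add, add_add_add_comm])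
  zero_smul x := Prod.ext (zero_smul _ _) (by
    change (0 : Γ(X, W)) • x.2 + tmulSec P _ W x.1 (differential f W 0) = 0
    rw [zero_smul, map_zero, map_zero, add_zero])

/-- The sheaf `P ⊕ (P ⊗ Ω_f)` with the twisted action of `jetModule`. Its `𝒪_X`-linear sections over
`P` are the connections on `P`. -/
def jetData : ModuleData X where
  sec W := Γ(P, W) × Γ(tensor P (relativeDifferentials f), W)
  module := jetModule f P
  res h := (resSec P h).toAddMonoidHom.prodMap
    (resSec (tensor P (relativeDifferentials f)) h).toAddMonoidHom
  res_self s := Prod.ext (resSec_self P s.1) (resSec_self _ s.2)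
  res_res h h' s := Prod.ext (resSec_resSec P h h' s.1) (resSec_resSec _ h h' s.2)
  res_smul {U V} h a s := Prod.ext ((resSec P h).map_smulₛₗ a s.1) (by
    change resSec _ h (a • s.2 + tmulSec P _ U s.1 (differential f U a)) =
      resFun h a • resSec _ h s.2 + tmulSec P _ V (resSec P h s.1) (differential f V (resFun h a))
    rw [map_add, map_smulₛₗ, resSec_tmulSec, resSec_differential])
  existsUnique_glue U s hs := by
    obtain ⟨t₁, h₁, h₁'⟩ := existsUnique_glue P U (iSup U) (le_iSup U) le_rfl (fun i ↦ (s i).1)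
      (fun i j ↦ congrArg Prod.fst (hs i j))
    obtain ⟨t₂, h₂, h₂'⟩ := existsUnique_glue (tensor P (relativeDifferentials f)) U (iSup U)
      (le_iSup U) le_rfl (fun i ↦ (s i).2) (fun i j ↦ congrArg Prod.snd (hs i j))
    exact ⟨(t₁, t₂), fun i ↦ Prod.ext (h₁ i) (h₂ i), fun t ht ↦ Prod.ext
      (h₁' _ fun i ↦ congrArg Prod.fst (ht i)) (h₂' _ fun i ↦ congrArg Prod.snd (ht i))⟩

variable (M : Y.Modules)

lemma exists_jetSection :
    ∃ σ : (Scheme.Modules.pullback f).obj M ⟶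
        (jetData f ((Scheme.Modules.pullback f).obj M)).toModules,
      ∀ W m, (σ.app (f ⁻¹ᵁ W) (pullbackSec f M W m) :
        (jetData f ((Scheme.Modules.pullback f).obj M)).sec (f ⁻¹ᵁ W)) = (pullbackSec f M W m, 0) :=
  exists_pullback_hom f (N := (jetData f ((Scheme.Modules.pullback f).obj M)).toModules)
    (fun W ↦
      { toFun := fun m ↦ ((pullbackSec f M W m, 0) :
          (jetData f ((Scheme.Modules.pullback f).obj M)).sec (f ⁻¹ᵁ W))
        map_add' := fun m m' ↦ Prod.ext (map_add _ _ _) (add_zero _).symm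
        map_smul' := fun a m ↦ Prod.ext (map_smulₛₗ _ _ _) (by
          change 0 = f.app W a • (0 : Γ(tensor _ (relativeDifferentials f), f ⁻¹ᵁ W)) +
            tmulSec _ _ _ (pullbackSec f M W m) (differential f _ (f.app W a))
          rw [differential_app, map_zero, smul_zero, add_zero]) })
    (fun W W' h m ↦ Prod.ext (pullbackSec_resSec f M h m) (map_zero (resSec _ _)).symm)

/-- The linear morphism `f^* M ⟶ f^* M ⊕ (f^* M ⊗ Ω_f)` which is `m ↦ (m, 0)` on pulled back
sections. -/
def jetSection :
    (Scheme.Modules.pullback f).obj M ⟶ (jetData f ((Scheme.Modules.pullback f).obj M)).toModules :=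
  (exists_jetSection f M).choose

lemma jetSection_pullbackSec (W : Y.Opens) (m : Γ(M, W)) :
    ((jetSection f M).app (f ⁻¹ᵁ W) (pullbackSec f M W m) :
      (jetData f ((Scheme.Modules.pullback f).obj M)).sec (f ⁻¹ᵁ W)) = (pullbackSec f M W m, 0) :=
  (exists_jetSection f M).choose_spec W m

lemma fst_jetSection (W : X.Opens) (x : Γ((Scheme.Modules.pullback f).obj M, W)) :
    ((jetSection f M).app W x : (jetData f ((Scheme.Modules.pullback f).obj M)).sec W).1 = x := by
  let fst : (jetData f ((Scheme.Modules.pullback f).obj M)).toModules ⟶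
      (Scheme.Modules.pullback f).obj M := homMk (fun W ↦
    { toFun := fun x ↦ (x : (jetData f ((Scheme.Modules.pullback f).obj M)).sec W).1
      map_add' := fun _ _ ↦ rfl
      map_smul' := fun _ _ ↦ rfl }) (fun _ _ _ _ ↦ rfl)
  have comp_fst : jetSection f M ≫ fst = 𝟙 _ := pullback_hom_ext f fun W m ↦
    congrArg Prod.fst (jetSection_pullbackSec f M W m)
  exact congrArg (fun k ↦ Scheme.Modules.Hom.app k W x) comp_fst

/-- The canonical connection on `f^* M`, relative to `Y`: the one killing all pulled back
sections. -/
def connection (W : X.Opens) : Γ((Scheme.Modules.pullback f).obj M, W) →+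
    Γ(tensor ((Scheme.Modules.pullback f).obj M) (relativeDifferentials f), W) :=
  (AddMonoidHom.snd _ _).comp
    (show Γ((Scheme.Modules.pullback f).obj M, W) →+
      (jetData f ((Scheme.Modules.pullback f).obj M)).sec W from ((jetSection f M).app W).hom)

lemma connection_resSec {U V : X.Opens} (h : V ≤ U)
    (x : Γ((Scheme.Modules.pullback f).obj M, U)) :
    connection f M V (resSec _ h x) = resSec _ h (connection f M U x) :=
  congrArg Prod.snd (app_resSec (jetSection f M) h x)

lemma connection_smul (W : X.Opens) (a : Γ(X, W)) (x : Γ((Scheme.Modules.pullback f).obj M, W)) :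
    connection f M W (a • x) = a • connection f M W x + tmulSec _ _ W x (differential f W a) := by
  refine (congrArg Prod.snd (Scheme.Modules.Hom.app_smul (jetSection f M) a x)).trans ?_
  exact congrArg (fun y ↦ _ + tmulSec _ _ W y (differential f W a)) (fst_jetSection f M W x)

lemma connection_pullbackSec (U : Y.Opens) (m : Γ(M, U)) :
    connection f M (f ⁻¹ᵁ U) (pullbackSec f M U m) = 0 :=
  congrArg Prod.snd (jetSection_pullbackSec f M U m)

end Connection

/-! ### Derivations of fields of positive characteristic -/

section Derivation

open IntermediateField

variable {K : Type*} [Field K]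

lemma D_eq_zero_of_adjoin_eq_top {k : Type*} [Field k] [Algebra k K] {a : K}
    (htop : k⟮a⟯ = ⊤) (ha : KaehlerDifferential.D k K a = 0) (x : K) :
    KaehlerDifferential.D k K x = 0 := by
  have hx : x ∈ k⟮a⟯ := htop ▸ mem_top
  induction hx using adjoin_induction with
  | mem x hx => rw [Set.mem_singleton_iff.1 hx, ha]
  | algebraMap x => exact Derivation.map_algebraMap _ x
  | add x y _ _ hx hy => rw [map_add, hx, hy, add_zero]
  | inv x _ hx => rw [Derivation.leibniz_inv, hx, smul_zero]
  | mul x y _ _ hx hy => rw [Derivation.leibniz, hx, hy, smul_zero, smul_zero, add_zero]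

lemma D_ne_zero_of_adjoin_eq_top {k : Type*} [Field k] [Algebra k K] [IsPurelyInseparable k K]
    {a : K} (htop : k⟮a⟯ = ⊤) (ha : a ∉ (algebraMap k K).range) :
    KaehlerDifferential.D k K a ≠ 0 := by
  intro hDa
  have : Subsingleton (Ω[K⁄k]) := by
    refine (Submodule.subsingleton_iff K).1 (subsingleton_of_bot_eq_top ?_)
    rw [← KaehlerDifferential.span_range_derivation, eq_comm, Submodule.span_eq_bot]
    rintro _ ⟨x, rfl⟩
    exact D_eq_zero_of_adjoin_eq_top htop hDa x
  have : Algebra.FormallyUnramified k K := ⟨this⟩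
  have : FiniteDimensional k K := by
    have := adjoin.finiteDimensional (Algebra.IsIntegral.isIntegral (R := k) a)
    rw [htop] at this
    exact Module.Finite.equiv (topEquiv (F := k) (E := K)).toLinearEquiv
  apply ha
  rw [Algebra.FormallyUnramified.range_eq_top_of_isPurelyInseparable k K]
  exact Subring.mem_top a

variable {p : ℕ} [hp : Fact p.Prime] [CharP K p]

lemma finrank_adjoin_of_pow_mem {L : Subfield K} {c : K} (hcp : c ^ p ∈ L) (hc : c ∉ L) :
    Module.finrank L L⟮c⟯ = p := by
  have irreducible : Irreducible (Polynomial.X ^ p - Polynomial.C (⟨c ^ p, hcp⟩ : L)) := by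
    refine X_pow_sub_C_irreducible_of_prime hp.out fun b hb ↦ hc ?_
    rw [← frobenius_inj K p (congrArg Subtype.val hb : (b : K) ^ p = c ^ p)]
    exact b.2
  have monic : (Polynomial.X ^ p - Polynomial.C (⟨c ^ p, hcp⟩ : L)).Monic :=
    Polynomial.monic_X_pow_sub_C _ hp.out.ne_zero
  have aeval_eq_zero :
      Polynomial.aeval c (Polynomial.X ^ p - Polynomial.C (⟨c ^ p, hcp⟩ : L)) = 0 := by
    simp only [map_sub, map_pow, Polynomial.aeval_X, Polynomial.aeval_C]
    exact sub_self _
  rw [adjoin.finrank ⟨_, monic, aeval_eq_zero⟩,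
    ← minpoly.eq_of_irreducible_of_monic irreducible aeval_eq_zero monic,
    Polynomial.natDegree_X_pow_sub_C]

lemma exists_maximal_subfield_notMem {a : K} (ha : ∀ b : K, b ^ p ≠ a) :
    ∃ L, Maximal (fun L : Subfield K ↦ (∀ c : K, c ^ p ∈ L) ∧ a ∉ L) L := by
  refine zorn_le₀ {L : Subfield K | (∀ c : K, c ^ p ∈ L) ∧ a ∉ L} fun chain hsub hchain ↦ ?_
  rcases chain.eq_empty_or_nonempty with rfl | hne
  · exact ⟨(frobenius K p).fieldRange, ⟨fun c ↦ ⟨c, rfl⟩, fun ⟨b, hb⟩ ↦ ha b hb⟩,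
      fun _ hL ↦ hL.elim⟩
  · refine ⟨sSup chain, ⟨fun x ↦ ?_, fun h ↦ ?_⟩, fun L hL ↦ le_sSup hL⟩
    · obtain ⟨L, hL⟩ := hne
      exact le_sSup hL ((hsub hL).1 x)
    · obtain ⟨L, hL, haL⟩ := (Subfield.mem_sSup_of_directedOn hne hchain.directedOn).1 h
      exact (hsub hL).2 haL

lemma adjoin_eq_top_of_maximal {a : K} {L : Subfield K}
    (hL : Maximal (fun L : Subfield K ↦ (∀ c : K, c ^ p ∈ L) ∧ a ∉ L) L) : L⟮a⟯ = ⊤ := by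
  obtain ⟨⟨hLp, hLa⟩, hmax⟩ := hL
  rw [eq_top_iff]
  intro b _
  by_cases hb : b ∈ L
  · exact L⟮a⟯.algebraMap_mem ⟨b, hb⟩
  have a_mem : a ∈ L⟮b⟯ := by
    by_contra h
    have hle : L ≤ L⟮b⟯.toSubfield := fun x hx ↦ L⟮b⟯.algebraMap_mem ⟨x, hx⟩
    exact hb (hmax (y := L⟮b⟯.toSubfield) ⟨fun c ↦ hle (hLp c), h⟩ hle
      (mem_adjoin_simple_self L b))
  have : FiniteDimensional L L⟮b⟯ :=
    Module.finite_of_finrank_pos (by rw [finrank_adjoin_of_pow_mem (hLp b) hb]; exact hp.out.pos)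
  have adjoin_eq : L⟮a⟯ = L⟮b⟯ := eq_of_le_of_finrank_eq (adjoin_simple_le_iff.2 a_mem)
    (by rw [finrank_adjoin_of_pow_mem (hLp a) hLa, finrank_adjoin_of_pow_mem (hLp b) hb])
  rw [adjoin_eq]
  exact mem_adjoin_simple_self L b

lemma isPurelyInseparable_of_pow_mem {L : Subfield K} (hLp : ∀ c : K, c ^ p ∈ L) :
    IsPurelyInseparable L K := by
  have : CharP L p := ((algebraMap L K).charP_iff (algebraMap L K).injective p).2 inferInstance
  have : ExpChar L p := .prime hp.out
  rw [isPurelyInseparable_iff_pow_mem L p]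
  exact fun x ↦ ⟨1, ⟨x ^ p, hLp x⟩, by rw [pow_one]; rfl⟩

lemma exists_derivation_ne_zero {a : K} (ha : ∀ b : K, b ^ p ≠ a) :
    ∃ D : Derivation ℤ K K, D a ≠ 0 := by
  obtain ⟨L, hL⟩ := exists_maximal_subfield_notMem ha
  have := isPurelyInseparable_of_pow_mem hL.1.1
  have hD : KaehlerDifferential.D L K a ≠ 0 :=
    D_ne_zero_of_adjoin_eq_top (adjoin_eq_top_of_maximal hL) fun ⟨b, hb⟩ ↦ hL.1.2 (hb ▸ b.2)
  obtain ⟨φ, hφ⟩ : ∃ φ : Module.Dual K (Ω[K⁄L]), φ (KaehlerDifferential.D L K a) ≠ 0 := by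
    by_contra! h
    exact hD ((Module.forall_dual_apply_eq_zero_iff K _).1 h)
  exact ⟨(φ.compDer (KaehlerDifferential.D L K)).restrictScalars ℤ, hφ⟩

end Derivation

/-! ### Rational functions on normal schemes -/

section FunctionField

variable [IrreducibleSpace X]

/-- The germ at the generic point. -/
def genericGerm {W : X.Opens} (h : genericPoint X ∈ W) : Γ(X, W) →+* X.functionField :=
  (X.presheaf.germ W (genericPoint X) h).hom

lemma genericGerm_resFun {U V : X.Opens} (hVU : V ≤ U) (h : genericPoint X ∈ V) (a : Γ(X, U)) :
    genericGerm h (resFun hVU a) = genericGerm (hVU h) a :=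
  X.presheaf.germ_res_apply (homOfLE hVU) _ h a

lemma genericPoint_mem {W : X.Opens} {x : X} (hx : x ∈ W) : genericPoint X ∈ W :=
  ((genericPoint_spec X).mem_open_set_iff W.isOpen).mpr ⟨x, trivial, hx⟩

end FunctionField

lemma genericGerm_injective [IsIntegral X] {W : X.Opens} (h : genericPoint X ∈ W) :
    Function.Injective (genericGerm h) :=
  germ_injective_of_isIntegral X (genericPoint X) h

lemma existsUnique_glue_fun {ι : Type u} (U : ι → X.Opens) (V : X.Opens)
    (hU : ∀ i, U i ≤ V) (hV : V ≤ iSup U) (s : ∀ i, Γ(X, U i))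
    (hs : ∀ i j, resFun (inf_le_left : U i ⊓ U j ≤ U i) (s i) = resFun inf_le_right (s j)) :
    ∃! t : Γ(X, V), ∀ i, resFun (hU i) t = s i :=
  TopCat.Sheaf.existsUnique_gluing' X.sheaf U V (fun i ↦ homOfLE (hU i)) hV s hs

lemma exists_genericGerm_eq [IsIntegral X] (hX : IsNormalScheme X) {W : X.Opens}
    (h : genericPoint X ∈ W) (k : X.functionField)
    (hk : ∀ x ∈ W, _root_.IsIntegral (X.presheaf.stalk x) k) :
    ∃ a : Γ(X, W), genericGerm h a = k := by
  have hloc (x : W) : ∃ (U : X.Opens) (_ : U ≤ W) (hx : x.1 ∈ U) (a : Γ(X, U)),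
      genericGerm (genericPoint_mem hx) a = k := by
    have := (hX x.1).2
    obtain ⟨y, hy⟩ := IsIntegrallyClosed.isIntegral_iff.1 (hk x.1 x.2)
    obtain ⟨U, hx, a, rfl⟩ := X.presheaf.exists_germ_eq y
    refine ⟨U ⊓ W, inf_le_right, ⟨hx, x.2⟩, resFun inf_le_left a, ?_⟩
    rw [genericGerm_resFun]
    have : Nonempty U := ⟨x.1, hx⟩
    rw [← hy, Scheme.algebraMap_germ_eq_germToFunctionField]
    rfl
  choose U hUW hxU a ha using hloc
  obtain ⟨t, ht, -⟩ := existsUnique_glue_fun U W hUW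
    (fun x hx ↦ Opens.mem_iSup.2 ⟨⟨x, hx⟩, hxU ⟨x, hx⟩⟩) a (fun x y ↦ by
      have hη : genericPoint X ∈ U x ⊓ U y :=
        ⟨genericPoint_mem (hxU x), genericPoint_mem (hxU y)⟩
      apply genericGerm_injective hη
      rw [genericGerm_resFun, genericGerm_resFun, ha, ha])
  let x : W := ⟨_, h⟩
  refine ⟨t, ?_⟩
  rw [← ha x, ← ht x, genericGerm_resFun]

section RationalFunctions

variable (X) [IrreducibleSpace X]

/-- The data of the sheaf of rational functions. Its sections over `W` are the functions from the
proofs of `genericPoint X ∈ W` to the function field, so that there is only one if `W` is empty. -/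
def rationalSectionsData : ModuleData X where
  sec W := PLift (genericPoint X ∈ W) → X.functionField
  module W :=
    { smul := fun a s h ↦ genericGerm h.down a * s h
      one_smul := fun s ↦ funext fun h ↦ by
        change genericGerm h.down 1 * s h = s h
        rw [map_one, one_mul]
      mul_smul := fun a b s ↦ funext fun h ↦ by
        change genericGerm h.down (a * b) * s h =
          genericGerm h.down a * (genericGerm h.down b * s h)
        rw [map_mul, mul_assoc]
      smul_zero := fun a ↦ funext fun h ↦ mul_zero _
      smul_add := fun a s t ↦ funext fun h ↦ mul_add _ _ _
      add_smul := fun a b s ↦ funext fun h ↦ by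
        change genericGerm h.down (a + b) * s h =
          genericGerm h.down a * s h + genericGerm h.down b * s h
        rw [map_add, add_mul]
      zero_smul := fun s ↦ funext fun h ↦ by
        change genericGerm h.down 0 * s h = 0
        rw [map_zero, zero_mul] }
  res {U V} hVU :=
    { toFun := fun s h ↦ s ⟨hVU h.down⟩
      map_zero' := rfl
      map_add' := fun _ _ ↦ rfl }
  res_self _ := rfl
  res_res _ _ _ := rfl
  res_smul {U V} hVU a s := funext fun h ↦ by
    change genericGerm (hVU h.down) a * _ = genericGerm h.down (resFun hVU a) * _
    rw [genericGerm_resFun]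
    rfl
  existsUnique_glue {ι} U s hs := by
    have eq_of_mem (i j : ι) (hi : genericPoint X ∈ U i) (hj : genericPoint X ∈ U j) :
        s i ⟨hi⟩ = s j ⟨hj⟩ := congrFun (hs i j) ⟨⟨hi, hj⟩⟩
    exact ⟨fun h ↦ s (Opens.mem_iSup.1 h.down).choose ⟨(Opens.mem_iSup.1 h.down).choose_spec⟩,
      fun i ↦ funext fun h ↦ eq_of_mem _ _ _ _, fun t ht ↦ funext fun h ↦
        congrFun (ht (Opens.mem_iSup.1 h.down).choose) ⟨(Opens.mem_iSup.1 h.down).choose_spec⟩⟩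

/-- The constant sheaf of rational functions. -/
def rationalFunctions : X.Modules := (rationalSectionsData X).toModules

variable {X}

/-- The rational function underlying a section of the sheaf of rational functions. -/
def rationalValue {W : X.Opens} (h : genericPoint X ∈ W) :
    Γ(rationalFunctions X, W) →+ X.functionField where
  toFun s := (show (rationalSectionsData X).sec W from s) ⟨h⟩
  map_zero' := rfl
  map_add' _ _ := rfl

lemma rationalValue_smul {W : X.Opens} (h : genericPoint X ∈ W) (a : Γ(X, W))
    (s : Γ(rationalFunctions X, W)) :
    rationalValue h (a • s) = genericGerm h a * rationalValue h s := rfl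

/-- The section of the sheaf of rational functions with a given underlying rational function. -/
def rationalSection (W : X.Opens) (s : genericPoint X ∈ W → X.functionField) :
    Γ(rationalFunctions X, W) :=
  show (rationalSectionsData X).sec W from fun h ↦ s h.down

lemma rationalValue_rationalSection {W : X.Opens} (h : genericPoint X ∈ W)
    (s : genericPoint X ∈ W → X.functionField) :
    rationalValue h (rationalSection W s) = s h := rfl

lemma rationalValue_resSec {U V : X.Opens} (hVU : V ≤ U) (h : genericPoint X ∈ V)
    (s : Γ(rationalFunctions X, U)) :
    rationalValue h (resSec _ hVU s) = rationalValue (hVU h) s := rfl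

lemma rationalFunctions_ext {W : X.Opens} {s t : Γ(rationalFunctions X, W)}
    (hst : ∀ h : genericPoint X ∈ W, rationalValue h s = rationalValue h t) : s = t :=
  funext (α := PLift (genericPoint X ∈ W)) (β := fun _ ↦ X.functionField) fun h ↦ hst h.down

end RationalFunctions

section Contraction

lemma connection_combination (f : X ⟶ Y) {M : Y.Modules} {ι : Type*} [Fintype ι] {U : Y.Opens}
    (m : ι → Γ(M, U)) {W : X.Opens} (hW : W ≤ f ⁻¹ᵁ U) (a : ι → Γ(X, W)) :
    connection f M W (combination _ (fun i ↦ pullbackSec f M U (m i)) hW a) =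
      ∑ i, tmulSec _ _ W (resSec _ hW (pullbackSec f M U (m i))) (differential f W (a i)) := by
  rw [combination_apply, map_sum]
  refine Finset.sum_congr rfl fun i _ ↦ ?_
  rw [connection_smul, connection_resSec, connection_pullbackSec, map_zero, smul_zero, zero_add]

variable [IrreducibleSpace X]

lemma exists_rationalValue_differential (f : X ⟶ Y)
    (δ : Derivation ℤ X.functionField X.functionField)
    (hδ : ∀ (W : Y.Opens) (h : genericPoint X ∈ f ⁻¹ᵁ W) (b : Γ(Y, W)),
      δ (genericGerm h (f.app W b)) = 0) :
    ∃ α : relativeDifferentials f ⟶ rationalFunctions X,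
      ∀ (W : X.Opens) (h : genericPoint X ∈ W) (b : Γ(X, W)),
        rationalValue h (α.app W (differential f W b)) = δ (genericGerm h b) := by
  obtain ⟨α, hα⟩ := exists_differentials_hom f (N := rationalFunctions X)
    (fun W ↦
      { toFun := fun b ↦ rationalSection W fun h ↦ δ (genericGerm h b)
        map_zero' := rationalFunctions_ext fun h ↦ by
          refine (rationalValue_rationalSection h _).trans ?_
          rw [map_zero, map_zero, map_zero]
        map_add' := fun a b ↦ rationalFunctions_ext fun h ↦ by
          simp only [map_add, rationalValue_rationalSection] })
    (fun W a b ↦ rationalFunctions_ext fun h ↦ by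
      rw [map_add, rationalValue_smul, rationalValue_smul]
      change δ (genericGerm h (a * b)) =
        genericGerm h a * δ (genericGerm h b) + genericGerm h b * δ (genericGerm h a)
      rw [map_mul, δ.leibniz]
      rfl)
    (fun V W hWV a ↦ rationalFunctions_ext fun h ↦ by
      rw [rationalValue_resSec]
      change δ (genericGerm h (resFun hWV a)) = δ (genericGerm _ a)
      rw [genericGerm_resFun])
    (fun W b ↦ rationalFunctions_ext fun h ↦
      (hδ W h b).trans (map_zero (rationalValue h)).symm)
  exact ⟨α, fun W h b ↦ congrArg (rationalValue h) (hα W b)⟩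

variable {P : X.Modules} {ι : Type*} [Fintype ι] {U : X.Opens} {e : ι → Γ(P, U)}

/-- The `i`-th coefficient at the generic point of a section of `P` over `W`, with respect to a
basis over `U`. Here `W` need not be contained in `U`. -/
def IsBasisOn.genericCoeff (he : IsBasisOn P e) (hU : genericPoint X ∈ U) (i : ι) {W : X.Opens}
    (h : genericPoint X ∈ W) : Γ(P, W) →ₛₗ[genericGerm h] X.functionField where
  toFun m := genericGerm (Opens.mem_inf.2 ⟨h, hU⟩)
    (he.coeff inf_le_right (resSec P inf_le_left m) i)
  map_add' m m' := by
    simp only [map_add, Pi.add_apply (M := fun _ ↦ Γ(X, W ⊓ U))]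
  map_smul' a m := by
    simp only [map_smulₛₗ, RingHom.id_apply, Pi.smul_apply (M := fun _ ↦ Γ(X, W ⊓ U)),
      smul_eq_mul, map_mul, genericGerm_resFun]

lemma IsBasisOn.genericCoeff_eq (he : IsBasisOn P e) (hU : genericPoint X ∈ U) (i : ι)
    {W : X.Opens} (hW : W ≤ U) (h : genericPoint X ∈ W) (m : Γ(P, W)) :
    he.genericCoeff hU i h m = genericGerm h (he.coeff hW m i) := by
  have coeff_inf := congrFun (he.coeff_resSec hW (inf_le_left : W ⊓ U ≤ W) m) i
  rw [← genericGerm_resFun (inf_le_left : W ⊓ U ≤ W) (Opens.mem_inf.2 ⟨h, hU⟩), ← coeff_inf]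
  rfl

lemma IsBasisOn.genericCoeff_resSec (he : IsBasisOn P e) (hU : genericPoint X ∈ U) (i : ι)
    {V W : X.Opens} (hWV : W ≤ V) (h : genericPoint X ∈ W) (m : Γ(P, V)) :
    he.genericCoeff hU i h (resSec P hWV m) = he.genericCoeff hU i (hWV h) m := by
  have coeff_inf := congrFun (he.coeff_resSec (inf_le_right : V ⊓ U ≤ U)
    (inf_le_inf_right U hWV) (resSec P inf_le_left m)) i
  refine Eq.trans ?_ (genericGerm_resFun (inf_le_inf_right U hWV) (Opens.mem_inf.2 ⟨h, hU⟩) _)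
  rw [← coeff_inf, resSec_resSec]
  change genericGerm _ (he.coeff _ (resSec P _ (resSec P hWV m)) i) = _
  rw [resSec_resSec]

lemma IsBasisOn.exists_contraction (he : IsBasisOn P e) (hU : genericPoint X ∈ U) (i : ι)
    {N : X.Modules} (α : N ⟶ rationalFunctions X) :
    ∃ ψ : tensor P N ⟶ rationalFunctions X,
      ∀ (W : X.Opens) (h : genericPoint X ∈ W) (m : Γ(P, W)) (n : Γ(N, W)),
        rationalValue h (ψ.app W (tmulSec P N W m n)) =
          he.genericCoeff hU i h m * rationalValue h (α.app W n) := by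
  obtain ⟨ψ, hψ⟩ := exists_tensor_hom (M := P) (N := N) (K := rationalFunctions X)
    (fun W ↦ LinearMap.mk₂ Γ(X, W)
      (fun m n ↦ rationalSection W fun h ↦
        he.genericCoeff hU i h m * rationalValue h (α.app W n))
      (fun m m' n ↦ rationalFunctions_ext fun h ↦ by
        rw [map_add, rationalValue_rationalSection, map_add, add_mul]
        rfl)
      (fun a m n ↦ rationalFunctions_ext fun h ↦ by
        rw [rationalValue_smul, rationalValue_rationalSection, map_smulₛₗ, smul_eq_mul, mul_assoc]
        rfl)
      (fun m n n' ↦ rationalFunctions_ext fun h ↦ by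
        rw [map_add, rationalValue_rationalSection, map_add, map_add, mul_add]
        rfl)
      (fun a m n ↦ rationalFunctions_ext fun h ↦ by
        rw [rationalValue_smul, rationalValue_rationalSection, Scheme.Modules.Hom.app_smul,
          rationalValue_smul, mul_left_comm]
        rfl))
    (fun V W hWV m n ↦ rationalFunctions_ext fun h ↦
      congrArg₂ (· * ·) (he.genericCoeff_resSec hU i hWV h m)
        (congrArg (rationalValue h) (app_resSec α hWV n)))
  exact ⟨ψ, fun W h m n ↦ congrArg (rationalValue h) (hψ W m n)⟩

/-- Contracting the connection with the derivation and the `i`-th coordinate gives the derivative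
of the `i`-th coefficient. -/
lemma derivation_coeff_eq_zero (f : X ⟶ Y) {M : Y.Modules} {U : Y.Opens} {m : ι → Γ(M, U)}
    (hm : IsBasisOn M m) (δ : Derivation ℤ X.functionField X.functionField)
    (hδ : ∀ (W : Y.Opens) (h : genericPoint X ∈ f ⁻¹ᵁ W) (b : Γ(Y, W)),
      δ (genericGerm h (f.app W b)) = 0)
    {W : X.Opens} (hW : W ≤ f ⁻¹ᵁ U) (h : genericPoint X ∈ W) (a : ι → Γ(X, W))
    (ha : connection f M W (combination _ (fun i ↦ pullbackSec f M U (m i)) hW a) = 0) (i : ι) :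
    δ (genericGerm h (a i)) = 0 := by
  classical
  have he := hm.pullback f
  obtain ⟨α, hα⟩ := exists_rationalValue_differential f δ hδ
  obtain ⟨ψ, hψ⟩ := he.exists_contraction (hW h) i α
  have contraction_eq (j : ι) : rationalValue h (ψ.app W (tmulSec _ _ W
      (resSec _ hW (pullbackSec f M U (m j))) (differential f W (a j)))) =
      genericGerm h (Pi.single (M := fun _ ↦ Γ(X, W)) j 1 i) * δ (genericGerm h (a j)) := by
    rw [hψ, hα, he.genericCoeff_eq (hW h) i hW h, he.coeff_basis]
  calc δ (genericGerm h (a i))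
      = ∑ j, genericGerm h (Pi.single (M := fun _ ↦ Γ(X, W)) j 1 i) *
          δ (genericGerm h (a j)) := by
        rw [Finset.sum_eq_single i]
        · rw [Pi.single_eq_same, map_one, one_mul]
        · intro j _ hj
          rw [Pi.single_eq_of_ne hj.symm, map_zero, zero_mul]
        · exact fun hi ↦ (hi (Finset.mem_univ i)).elim
    _ = rationalValue h (ψ.app W
          (connection f M W (combination _ (fun i ↦ pullbackSec f M U (m i)) hW a))) := by
        rw [connection_combination, map_sum, map_sum]
        exact Finset.sum_congr rfl fun j _ ↦ (contraction_eq j).symm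
    _ = 0 := by rw [ha, map_zero, map_zero]

end Contraction

lemma pullbackSec_combination (f : X ⟶ Y) {M : Y.Modules} {ι : Type*} [Fintype ι] {U : Y.Opens}
    (e : ι → Γ(M, U)) {W : Y.Opens} (h : W ≤ U) (a : ι → Γ(Y, W)) :
    pullbackSec f M W (combination M e h a) = combination ((Scheme.Modules.pullback f).obj M)
      (fun i ↦ pullbackSec f M U (e i)) (f.preimage_mono h) (fun i ↦ f.app W (a i)) := by
  rw [combination_apply, combination_apply, map_sum]
  refine Finset.sum_congr rfl fun i _ ↦ ?_
  rw [map_smulₛₗ, pullbackSec_resSec]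

lemma IsLocallyFree.exists_nbhd_basis {M : X.Modules} (hM : IsLocallyFree M) (W : X.Opens) (x : W) :
    ∃ (V : X.Opens) (_ : V ≤ W) (_ : x.1 ∈ V) (n : ℕ) (e : Fin n → Γ(M, V)), IsBasisOn M e := by
  obtain ⟨U, hx, n, e, he⟩ := hM x
  refine ⟨U ⊓ W, inf_le_right, ⟨hx, x.2⟩, n, fun i ↦ resSec M inf_le_left (e i), fun V hV ↦ ?_⟩
  convert he V (hV.trans inf_le_left) using 1
  ext a
  simp only [combination_apply, resSec_resSec]

/-! ### Horizontal sections of Frobenius pull-backs -/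

lemma charP_of_ringHom (p : ℕ) [Fact p.Prime] {A K : Type*} [CommRing A] [Field K] (φ : A →+* K)
    (hp : (p : A) = 0) : CharP K p := by
  rw [CharP.charP_iff_prime_eq_zero Fact.out, ← map_natCast φ, hp, map_zero]

section Frobenius

variable (p : ℕ) [Fact p.Prime] [IsIntegral X] (hp : (p : Γ(X, ⊤)) = 0)

lemma genericGerm_frobenius {W : X.Opens} (h : genericPoint X ∈ W) (b : Γ(X, W)) :
    genericGerm (W := absoluteFrobenius p X hp ⁻¹ᵁ W) h ((absoluteFrobenius p X hp).app W b) =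
      genericGerm h b ^ p :=
  map_pow (genericGerm h) b p

include hp in
lemma charP_functionField : CharP X.functionField p :=
  charP_of_ringHom p (genericGerm (W := ⊤) trivial) hp

lemma derivation_genericGerm_frobenius (δ : Derivation ℤ X.functionField X.functionField)
    (W : X.Opens) (h : genericPoint X ∈ absoluteFrobenius p X hp ⁻¹ᵁ W) (b : Γ(X, W)) :
    δ (genericGerm h ((absoluteFrobenius p X hp).app W b)) = 0 := by
  have := charP_functionField p hp
  refine (congrArg δ (genericGerm_frobenius p hp h b)).trans ?_
  rw [δ.leibniz_pow, nsmul_eq_mul, CharP.cast_eq_zero, zero_mul]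

lemma frobenius_app_injective {W : X.Opens} (h : genericPoint X ∈ W) :
    Function.Injective ((absoluteFrobenius p X hp).app W) := by
  intro a b hab
  have := charP_functionField p hp
  apply genericGerm_injective h
  apply frobenius_inj X.functionField p
  rw [frobenius_def, frobenius_def, ← genericGerm_frobenius p hp h, ← genericGerm_frobenius p hp h]
  exact congrArg (genericGerm (W := absoluteFrobenius p X hp ⁻¹ᵁ W) h) hab

lemma pullbackSec_frobenius_injective {M : X.Modules} (hM : IsLocallyFree M) (W : X.Opens) :
    Function.Injective (pullbackSec (absoluteFrobenius p X hp) M W) := by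
  rw [injective_iff_map_eq_zero]
  intro m hm
  choose V hVW hxV n e he using hM.exists_nbhd_basis W
  refine eq_of_locally_eq M V W hVW (fun x hx ↦ Opens.mem_iSup.2 ⟨⟨x, hx⟩, hxV ⟨x, hx⟩⟩) _ _
    fun x ↦ ?_
  have pullback_eq_zero := pullbackSec_resSec (absoluteFrobenius p X hp) M (hVW x) m
  rw [hm, map_zero, ← (he x).combination_coeff le_rfl (resSec M (hVW x) m),
    pullbackSec_combination] at pullback_eq_zero
  have app_coeff_eq_zero := ((he x).pullback (absoluteFrobenius p X hp) _ _).1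
    (pullback_eq_zero.trans (map_zero _).symm)
  have coeff_eq_zero : (he x).coeff le_rfl (resSec M (hVW x) m) = 0 := by
    funext i
    apply frobenius_app_injective p hp (genericPoint_mem (hxV x))
    exact (congrFun app_coeff_eq_zero i).trans (map_zero _).symm
  rw [map_zero, ← (he x).combination_coeff le_rfl (resSec M (hVW x) m), coeff_eq_zero, map_zero]

lemma exists_frobenius_app_eq (hX : IsNormalScheme X) {W : X.Opens} (h : genericPoint X ∈ W)
    (a : Γ(X, absoluteFrobenius p X hp ⁻¹ᵁ W))
    (ha : ∀ δ : Derivation ℤ X.functionField X.functionField,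
      δ (genericGerm (W := absoluteFrobenius p X hp ⁻¹ᵁ W) h a) = 0) :
    ∃ b : Γ(X, W), (absoluteFrobenius p X hp).app W b = a := by
  have := charP_functionField p hp
  obtain ⟨k, hk⟩ : ∃ k, k ^ p = genericGerm (W := absoluteFrobenius p X hp ⁻¹ᵁ W) h a := by
    by_contra! not_pow
    obtain ⟨δ, hδ⟩ := exists_derivation_ne_zero not_pow
    exact hδ (ha δ)
  obtain ⟨b, hb⟩ := exists_genericGerm_eq hX h k fun z hz ↦ by
    refine IsIntegral.of_pow (Fact.out : p.Prime).pos ?_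
    have : Nonempty W := ⟨z, hz⟩
    rw [hk, show genericGerm (W := absoluteFrobenius p X hp ⁻¹ᵁ W) h a = _ from
      (Scheme.algebraMap_germ_eq_germToFunctionField (X := X) (U := W) hz a).symm]
    exact isIntegral_algebraMap
  refine ⟨b, genericGerm_injective (W := absoluteFrobenius p X hp ⁻¹ᵁ W) h ?_⟩
  rw [genericGerm_frobenius p hp h b, hb, hk]

lemma IsBasisOn.exists_pullbackSec_frobenius_eq (hX : IsNormalScheme X) {M : X.Modules}
    {ι : Type*} [Fintype ι] {W : X.Opens} {e : ι → Γ(M, W)} (he : IsBasisOn M e)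
    (hW : genericPoint X ∈ W)
    (x : Γ((Scheme.Modules.pullback (absoluteFrobenius p X hp)).obj M,
      absoluteFrobenius p X hp ⁻¹ᵁ W))
    (hx : connection (absoluteFrobenius p X hp) M _ x = 0) :
    ∃ m : Γ(M, W), pullbackSec (absoluteFrobenius p X hp) M W m = x := by
  obtain ⟨a, rfl⟩ := (he.pullback (absoluteFrobenius p X hp) _ le_rfl).2 x
  have exists_root (i : ι) : ∃ b : Γ(X, W), (absoluteFrobenius p X hp).app W b = a i :=
    exists_frobenius_app_eq p hp hX hW (a i) fun δ ↦ derivation_coeff_eq_zero _ he δ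
      (derivation_genericGerm_frobenius p hp δ) le_rfl hW a hx i
  choose b hb using exists_root
  refine ⟨combination M e le_rfl b, ?_⟩
  rw [pullbackSec_combination]
  exact congrArg _ (funext hb)

/-- Cartier's theorem on the horizontal sections of a Frobenius pull-back, for normal schemes. -/
lemma exists_pullbackSec_frobenius_eq (hX : IsNormalScheme X) {M : X.Modules} (hM : IsLocallyFree M)
    (W : X.Opens) (x : Γ((Scheme.Modules.pullback (absoluteFrobenius p X hp)).obj M,
      absoluteFrobenius p X hp ⁻¹ᵁ W))
    (hx : connection (absoluteFrobenius p X hp) M _ x = 0) :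
    ∃ m : Γ(M, W), pullbackSec (absoluteFrobenius p X hp) M W m = x := by
  let F := absoluteFrobenius p X hp
  choose V hVW hxV n e he using hM.exists_nbhd_basis W
  have exists_local (y : W) : ∃ m : Γ(M, V y),
      pullbackSec F M (V y) m = resSec _ (F.preimage_mono (hVW y)) x :=
    (he y).exists_pullbackSec_frobenius_eq p hp hX (genericPoint_mem (hxV y)) _
      (by rw [connection_resSec, hx, map_zero])
  choose m hm using exists_local
  have hcover : W ≤ iSup V := fun y hy ↦ Opens.mem_iSup.2 ⟨⟨y, hy⟩, hxV ⟨y, hy⟩⟩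
  obtain ⟨t, ht, -⟩ := existsUnique_glue M V W hVW hcover m fun y z ↦ by
    apply pullbackSec_frobenius_injective p hp hM
    rw [pullbackSec_resSec, pullbackSec_resSec]
    refine (congrArg _ (hm y)).trans (Eq.trans ?_ (congrArg _ (hm z)).symm)
    rw [resSec_resSec, resSec_resSec]
  refine ⟨t, eq_of_locally_eq _ (fun y ↦ F ⁻¹ᵁ V y) _ (fun y ↦ F.preimage_mono (hVW y))
    (fun y hy ↦ Opens.mem_iSup.2 (Opens.mem_iSup.1 (hcover hy))) _ _ fun y ↦ ?_⟩
  rw [← hm, ← ht, pullbackSec_resSec]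

end Frobenius

/-! ### Descending splittings along the Frobenius -/

lemma constantZ_hom_eq_zero {G : AbSheaf X} (hG : Subsingleton (G.obj.obj (op ⊤)))
    (t : constantZ X ⟶ G) : t = 0 := by
  apply ((constantSheafAdj (Opens.grothendieckTopology X) AddCommGrpCat.{u}
    (isTerminalTop : IsTerminal (⊤ : X.Opens))).homEquiv _ _).injective
  ext x
  exact hG.elim _ _

/-- The morphism of abelian sheaves with a given action on sections. -/
def abMk {E G : AbSheaf X} (a : ∀ U : X.Opens, E.obj.obj (op U) →+ G.obj.obj (op U))
    (ha : ∀ (U V : X.Opens) (h : V ≤ U) (m : E.obj.obj (op U)),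
      a V (E.obj.map (homOfLE h).op m) = G.obj.map (homOfLE h).op (a U m)) : E ⟶ G :=
  ⟨{ app := fun U ↦ AddCommGrpCat.ofHom (a U.unop)
     naturality := fun U V f ↦ by
       ext m
       exact ha _ _ f.unop.le m }⟩

lemma eq_of_comp_eq_of_injective {E G G' : AbSheaf X} (j : G ⟶ G')
    (hj : ∀ U : X.Opens, Function.Injective (j.hom.app (op U)).hom) {a b : E ⟶ G}
    (h : a ≫ j = b ≫ j) : a = b := by
  ext U x
  exact hj U.unop (congrArg (fun k : E ⟶ G' ↦ (k.hom.app U).hom x) h)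

lemma exists_lift_of_injective {E G G' : AbSheaf X} (j : G ⟶ G')
    (hj : ∀ U : X.Opens, Function.Injective (j.hom.app (op U)).hom) (h : E ⟶ G')
    (hh : ∀ (U : X.Opens) (x : E.obj.obj (op U)), ∃ y : G.obj.obj (op U),
      (j.hom.app (op U)).hom y = (h.hom.app (op U)).hom x) :
    ∃ k : E ⟶ G, k ≫ j = h := by
  choose k hk using hh
  refine ⟨abMk (fun U ↦
    { toFun := k U
      map_zero' := hj U (by rw [hk, map_zero, map_zero])
      map_add' := fun x y ↦ hj U (by rw [hk, map_add, map_add, hk, hk]) })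
    (fun U V hVU x ↦ hj V ?_), ?_⟩
  · have nat_h := ConcreteCategory.congr_hom (h.hom.naturality (homOfLE hVU).op) x
    have nat_j := ConcreteCategory.congr_hom (j.hom.naturality (homOfLE hVU).op) (k U x)
    refine (hk V _).trans (nat_h.trans (Eq.trans ?_ nat_j.symm))
    exact congrArg (G'.obj.map (homOfLE hVU).op) (hk U x).symm
  · ext U x
    exact hk U.unop x

/-- The canonical connection on `f^* M` as a morphism of abelian sheaves. -/
def connectionAb (f : X ⟶ Y) (M : Y.Modules) :
    toAbSheaf ((Scheme.Modules.pullback f).obj M) ⟶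
      toAbSheaf (tensor ((Scheme.Modules.pullback f).obj M) (relativeDifferentials f)) :=
  abMk (connection f M) fun _ _ h x ↦ connection_resSec f M h x

lemma exists_comp_unitAb_frobenius_eq (p : ℕ) [Fact p.Prime] [IsIntegral X]
    (hp : (p : Γ(X, ⊤)) = 0) (hX : IsNormalScheme X) (f : X ⟶ Z) {P : X.Modules}
    (hP : IsLocallyFree P) {E : AbSheaf Z}
    (h : E ⟶ (directImage f).obj ((directImage (absoluteFrobenius p X hp)).obj
      (toAbSheaf ((Scheme.Modules.pullback (absoluteFrobenius p X hp)).obj P))))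
    (hh : h ≫ (directImage f).map ((directImage _).map (connectionAb _ P)) = 0) :
    ∃ k : E ⟶ (directImage f).obj (toAbSheaf P),
      k ≫ (directImage f).map (unitAb (absoluteFrobenius p X hp) P) = h :=
  exists_lift_of_injective _ (fun U ↦ pullbackSec_frobenius_injective p hp hP (f ⁻¹ᵁ U)) h
    fun U x ↦ exists_pullbackSec_frobenius_eq p hp hX hP (f ⁻¹ᵁ U) _
      (congrArg (fun k : E ⟶ (directImage f).obj ((directImage _).obj (toAbSheaf _)) ↦
        (k.hom.app (op U)).hom x) hh)

lemma SplitsAfterPullback.of_frobenius_comp (p : ℕ) [Fact p.Prime] [IsIntegral X]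
    (hp : (p : Γ(X, ⊤)) = 0) (hX : IsNormalScheme X) (f : X ⟶ Z) {M : Z.Modules}
    (hM : IsLocallyFree ((Scheme.Modules.pullback f).obj M)) {E : AbSheaf Z} {i : toAbSheaf M ⟶ E}
    {q : E ⟶ constantZ Z} {hz : i ≫ q = 0} (hS : (ShortComplex.mk i q hz).ShortExact)
    (h₀ : Subsingleton Γ(tensor ((Scheme.Modules.pullback (absoluteFrobenius p X hp)).obj
      ((Scheme.Modules.pullback f).obj M)) (relativeDifferentials (absoluteFrobenius p X hp)), ⊤))
    (h : SplitsAfterPullback (absoluteFrobenius p X hp ≫ f) i) : SplitsAfterPullback f i := by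
  let F := absoluteFrobenius p X hp
  let P := (Scheme.Modules.pullback f).obj M
  obtain ⟨h, hh⟩ := (splitsAfterPullback_comp_iff F f i).1 h
  let d := (directImage f).map ((directImage F).map (connectionAb F P))
  have i_comp : i ≫ h ≫ d = 0 := by
    rw [reassoc_of% hh]
    ext U m
    exact connection_pullbackSec F P _ _
  have := hS.epi_g
  obtain ⟨t, ht⟩ : ∃ t, q ≫ t = h ≫ d :=
    ⟨hS.exact.desc (h ≫ d) i_comp, hS.exact.g_desc _ i_comp⟩
  have comp_d : h ≫ d = 0 := by
    rw [← ht, constantZ_hom_eq_zero (X := Z) (G := (directImage f).obj _) h₀ t]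
    exact comp_zero
  obtain ⟨k, hk⟩ := exists_comp_unitAb_frobenius_eq p hp hX f hM h comp_d
  refine ⟨k, eq_of_comp_eq_of_injective ((directImage f).map (unitAb F P))
    (fun U ↦ pullbackSec_frobenius_injective p hp hM (f ⁻¹ᵁ U)) ?_⟩
  exact (Category.assoc _ _ _).trans ((congrArg (i ≫ ·) hk).trans hh)

/-! ### Finite generically inseparable morphisms to normal schemes -/

section PowerSubfield

variable {K L : Type*} [Field K] [Field L] (φ : K →+* L) (p : ℕ) [ExpChar L p]

/-- The subfield of `L` of the elements whose `p ^ n`-th power comes from `K`. -/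
def powSubfield (n : ℕ) : Subfield L :=
  φ.fieldRange.comap (iterateFrobenius L p n)

variable {φ p}

lemma mem_powSubfield {n : ℕ} {l : L} : l ∈ powSubfield φ p n ↔ ∃ k, φ k = l ^ p ^ n := by
  change iterateFrobenius L p n l ∈ φ.fieldRange ↔ _
  rw [RingHom.mem_fieldRange, iterateFrobenius_def]

lemma powSubfield_mono {m n : ℕ} (hmn : m ≤ n) : powSubfield φ p m ≤ powSubfield φ p n := by
  intro l hl
  obtain ⟨k, hk⟩ := mem_powSubfield.1 hl
  refine mem_powSubfield.2 ⟨k ^ p ^ (n - m), ?_⟩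
  rw [map_pow, hk, ← pow_mul, ← pow_add, Nat.add_sub_cancel' hmn]

lemma exists_forall_mem_powSubfield {A B : Type*} [CommRing A] [CommRing B] [Algebra A B]
    [Module.Finite A B] (v : B →+* L) (hA : ∀ a, ∃ k, φ k = v (algebraMap A B a))
    (hB : ∀ b, ∃ n, v b ∈ powSubfield φ p n) : ∃ n, ∀ b, v b ∈ powSubfield φ p n := by
  obtain ⟨m, s, hs⟩ := Module.Finite.exists_fin (R := A) (M := B)
  choose e he using fun i ↦ hB (s i)
  refine ⟨Finset.univ.sup e, fun b ↦ ?_⟩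
  have hb : b ∈ Submodule.span A (Set.range s) := hs ▸ Submodule.mem_top
  induction hb using Submodule.span_induction with
  | mem x hx =>
    obtain ⟨i, rfl⟩ := hx
    exact powSubfield_mono (Finset.le_sup (Finset.mem_univ i)) (he i)
  | zero => exact (map_zero v).symm ▸ zero_mem _
  | add x y _ _ hx hy => exact (map_add v x y).symm ▸ add_mem hx hy
  | smul a x _ hx =>
    rw [Algebra.smul_def, map_mul]
    refine mul_mem (powSubfield_mono (Nat.zero_le _) (mem_powSubfield.2 ?_)) hx
    rw [pow_zero, pow_one]
    exact hA a

lemma exists_ringHom_eq_pow {A B : Type*} [CommRing A] [CommRing B] (i : A →+* L)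
    (hi : Function.Injective i) (v : B →+* L) (n : ℕ) (h : ∀ b, ∃ a, i a = v b ^ p ^ n) :
    ∃ ψ : B →+* A, ∀ b, i (ψ b) = v b ^ p ^ n := by
  have mem_range (b : B) : ((iterateFrobenius L p n).comp v) b ∈ i.range := h b
  let e : A ≃+* i.range :=
    .ofBijective i.rangeRestrict
      ⟨fun a b hab ↦ hi (congrArg Subtype.val hab), i.rangeRestrict_surjective⟩
  exact ⟨e.symm.toRingHom.comp (((iterateFrobenius L p n).comp v).codRestrict i.range mem_range),
    fun b ↦ congrArg Subtype.val (e.apply_symm_apply _)⟩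

end PowerSubfield

section GenericValue

variable [IrreducibleSpace X]

/-- The value of a function at the generic point, in the residue field. It vanishes on nilpotent
functions, as opposed to `genericGerm`. -/
def genericValue {V : X.Opens} (h : genericPoint X ∈ V) :
    Γ(X, V) →+* X.residueField (genericPoint X) :=
  (X.evaluation V _ h).hom

lemma genericValue_resFun {U V : X.Opens} (hVU : V ≤ U) (h : genericPoint X ∈ V) (a : Γ(X, U)) :
    genericValue h (resFun hVU a) = genericValue (hVU h) a :=
  congrArg (X.residue (genericPoint X)) (X.presheaf.germ_res_apply (homOfLE hVU) _ h a)

lemma basicOpen_le_of_genericValue_eq {V : X.Opens} (h : genericPoint X ∈ V) {a b : Γ(X, V)}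
    (hab : genericValue h a = genericValue h b) : X.basicOpen a ≤ X.basicOpen b := by
  have sub_eq_zero' : genericValue h (a - b) = 0 := by rw [map_sub, hab, sub_self]
  have basicOpen_sub : X.basicOpen (a - b) = ⊥ := by
    rw [eq_bot_iff]
    intro x hx
    exact ((X.evaluation_eq_zero_iff_notMem_basicOpen _ h _).1 sub_eq_zero'
      (genericPoint_mem hx)).elim
  rw [Scheme.basicOpen_eq_bot_iff_forall_evaluation_eq_zero] at basicOpen_sub
  intro x hx
  have hxV := X.basicOpen_le a hx
  have evaluation_eq : X.evaluation V x hxV a = X.evaluation V x hxV b := by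
    rw [← sub_eq_zero, ← map_sub]
    exact basicOpen_sub ⟨x, hxV⟩
  rw [← X.evaluation_ne_zero_iff_mem_basicOpen x hxV, ← evaluation_eq]
  exact (X.evaluation_ne_zero_iff_mem_basicOpen x hxV a).2 hx

lemma basicOpen_eq_of_genericValue_eq {V : X.Opens} (h : genericPoint X ∈ V) {a b : Γ(X, V)}
    (hab : genericValue h a = genericValue h b) : X.basicOpen a = X.basicOpen b :=
  le_antisymm (basicOpen_le_of_genericValue_eq h hab) (basicOpen_le_of_genericValue_eq h hab.symm)

lemma eq_bot_of_genericPoint_notMem {W : X.Opens} (hW : genericPoint X ∉ W) : W = ⊥ :=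
  eq_bot_iff.2 fun _ hx ↦ (hW (genericPoint_mem hx)).elim

lemma subsingleton_sections {W : X.Opens} (hW : genericPoint X ∉ W) : Subsingleton Γ(X, W) := by
  rw [eq_bot_of_genericPoint_notMem hW]
  infer_instance

lemma exists_genericValue_eq_div {U V : X.Opens} (hU : IsAffineOpen U)
    (hηU : genericPoint X ∈ U) (hV : genericPoint X ∈ V) (b : Γ(X, V)) :
    ∃ s t : Γ(X, U), genericValue hV b = genericValue hηU t / genericValue hηU s := by
  obtain ⟨s, hsV, hηs⟩ := hU.exists_basicOpen_le ⟨_, hV⟩ hηU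
  have := hU.isLocalization_basicOpen s
  obtain ⟨n, t, ht⟩ := IsLocalization.Away.surj s (resFun hsV b)
  have value_algebraMap (c : Γ(X, U)) :
      genericValue hηs (algebraMap Γ(X, U) Γ(X, X.basicOpen s) c) = genericValue hηU c :=
    genericValue_resFun (X.basicOpen_le s) hηs c
  have value_mul_pow := congrArg (genericValue hηs) ht
  rw [map_mul, map_pow, value_algebraMap, value_algebraMap, genericValue_resFun] at value_mul_pow
  have value_ne_zero : genericValue hηU s ≠ 0 :=
    (X.evaluation_ne_zero_iff_mem_basicOpen _ hηU s).2 hηs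
  refine ⟨s ^ n, t, ?_⟩
  rw [map_pow]
  exact eq_div_of_mul_eq (pow_ne_zero n value_ne_zero) value_mul_pow

end GenericValue

section GenericResidueMap

variable [IrreducibleSpace X]

section Irreducible

variable [IrreducibleSpace Y] (f : X ⟶ Y) [IsDominant f]

lemma map_genericPoint : f (genericPoint X) = genericPoint Y := by
  refine (genericPoint_spec Y).eq ?_ |>.symm
  have image_spec := (genericPoint_spec X).image f.continuous
  rwa [Set.image_univ, f.denseRange.closure_range] at image_spec

lemma genericPoint_mem_preimage {W : Y.Opens} (hW : genericPoint Y ∈ W) :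
    genericPoint X ∈ f ⁻¹ᵁ W := by
  change f (genericPoint X) ∈ W
  rwa [map_genericPoint]

/-- The homomorphism from the function field of `Y` to the residue field at the generic point of
`X`. -/
def genericResidueMap : Y.functionField →+* X.residueField (genericPoint X) :=
  (Y.presheaf.stalkSpecializes (specializes_of_eq (map_genericPoint f)) ≫
    f.stalkMap (genericPoint X) ≫ X.residue (genericPoint X)).hom

lemma genericResidueMap_genericGerm {W : Y.Opens} (hW : genericPoint Y ∈ W) (a : Γ(Y, W)) :
    genericResidueMap f (genericGerm hW a) =
      genericValue (genericPoint_mem_preimage f hW) (f.app W a) := by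
  have germ_specializes := Y.presheaf.germ_stalkSpecializes_apply (U := W) hW
    (specializes_of_eq (map_genericPoint f)) a
  refine (congrArg (fun s ↦ X.residue _ (f.stalkMap _ s)) germ_specializes).trans ?_
  exact congrArg (X.residue _) (f.germ_stalkMap_apply W _ (genericPoint_mem_preimage f hW) a)

end Irreducible

variable [IsIntegral Y] (f : X ⟶ Y) [IsDominant f]
  (p : ℕ) [ExpChar (X.residueField (genericPoint X)) p]

lemma IsGenericallyInseparable.exists_mem_powSubfield (h : IsGenericallyInseparable f)
    (l : X.residueField (genericPoint X)) : ∃ n, l ∈ powSubfield (genericResidueMap f) p n := by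
  let := (f.residueFieldMap (genericPoint X)).hom.toAlgebra
  have : IsPurelyInseparable (Y.residueField (f (genericPoint X)))
    (X.residueField (genericPoint X)) := h.2
  have : ExpChar (Y.residueField (f (genericPoint X))) p :=
    ((f.residueFieldMap (genericPoint X)).hom.expChar_iff (RingHom.injective _) p).2 ‹_›
  obtain ⟨n, y, hy⟩ := IsPurelyInseparable.pow_mem (Y.residueField (f (genericPoint X))) p l
  obtain ⟨y, rfl⟩ := Y.residue_surjective _ y
  obtain ⟨k, rfl⟩ : ∃ k,
      Y.presheaf.stalkSpecializes (specializes_of_eq (map_genericPoint f)) k = y := by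
    obtain ⟨U, hU, b, rfl⟩ := Y.presheaf.exists_germ_eq y
    exact ⟨genericGerm (map_genericPoint f ▸ hU) b, Y.presheaf.germ_stalkSpecializes_apply _ _ b⟩
  refine ⟨n, mem_powSubfield.2 ⟨k, hy ▸ ?_⟩⟩
  exact (ConcreteCategory.congr_hom (Scheme.residue_residueFieldMap f (genericPoint X)) _).symm

lemma IsGenericallyInseparable.exists_forall_genericValue_mem [IsFinite f]
    (h : IsGenericallyInseparable f) :
    ∃ n, ∀ (V : X.Opens) (hV : genericPoint X ∈ V) (b : Γ(X, V)),
      genericValue hV b ∈ powSubfield (genericResidueMap f) p n := by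
  obtain ⟨_, ⟨U, hU, rfl⟩, hηU, -⟩ := Y.isBasis_affineOpens.exists_subset_of_mem_open
    (Set.mem_univ (genericPoint Y)) isOpen_univ
  let := (f.app U).hom.toAlgebra
  have : Module.Finite Γ(Y, U) Γ(X, f ⁻¹ᵁ U) := IsFinite.finite_app f U hU
  have hηU' := genericPoint_mem_preimage f hηU
  obtain ⟨n, hn⟩ := exists_forall_mem_powSubfield (A := Γ(Y, U)) (p := p) (genericValue hηU')
    (fun a ↦ ⟨genericGerm hηU a, genericResidueMap_genericGerm f hηU a⟩)
    (fun b ↦ h.exists_mem_powSubfield f p _)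
  refine ⟨n, fun V hV b ↦ ?_⟩
  obtain ⟨s, t, hst⟩ := exists_genericValue_eq_div (hU.preimage f) hηU' hV b
  exact hst ▸ div_mem (hn t) (hn s)

end GenericResidueMap

section GenericPower

variable [IrreducibleSpace X] [IsIntegral Y] (f : X ⟶ Y) [IsDominant f]

lemma exists_genericGerm_eq_of_genericResidueMap_eq [IsIntegralHom f] (hY : IsNormalScheme Y)
    {W : Y.Opens} (hW : genericPoint Y ∈ W) (b : Γ(X, f ⁻¹ᵁ W)) {k : Y.functionField}
    (hk : genericResidueMap f k = genericValue (genericPoint_mem_preimage f hW) b) :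
    ∃ a, genericGerm hW a = k := by
  refine exists_genericGerm_eq hY hW k fun y hy ↦ ?_
  obtain ⟨_, ⟨U, hU, rfl⟩, hyU, hUW⟩ := Y.isBasis_affineOpens.exists_subset_of_mem_open hy W.isOpen
  have hηU : genericPoint Y ∈ U := genericPoint_mem hyU
  obtain ⟨P, hP, hPb⟩ := IsIntegralHom.isIntegral_app f U hU
    (resFun (f.preimage_mono (show U ≤ W from hUW)) b)
  have residue_eval : P.eval₂ ((genericResidueMap f).comp (genericGerm hηU))
      (genericResidueMap f k) = 0 := by
    have value_eval := congrArg (genericValue (genericPoint_mem_preimage f hηU)) hPb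
    rw [Polynomial.hom_eval₂, map_zero, genericValue_resFun] at value_eval
    rw [hk, ← value_eval]
    congr 1
    exact RingHom.ext (genericResidueMap_genericGerm f hηU)
  rw [← Polynomial.hom_eval₂, map_eq_zero] at residue_eval
  have : Nonempty U := ⟨y, hyU⟩
  refine ⟨P.map (Y.presheaf.germ U y hyU).hom, hP.map _, ?_⟩
  rw [Polynomial.eval₂_map, ← residue_eval]
  congr 1
  exact RingHom.ext (Scheme.algebraMap_germ_eq_germToFunctionField (X := Y) hyU)

/-- The homomorphisms `ψ` from functions on `X` to functions on `Y` take `n`-th powers modulo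
nilpotents, that is, in the residue field at the generic point of `X`. -/
def IsPowerMap (n : ℕ) (ψ : ∀ W : Y.Opens, Γ(X, f ⁻¹ᵁ W) →+* Γ(Y, W)) : Prop :=
  ∀ (W : Y.Opens) (hW : genericPoint Y ∈ W) (b : Γ(X, f ⁻¹ᵁ W)),
    genericResidueMap f (genericGerm hW (ψ W b)) =
      genericValue (genericPoint_mem_preimage f hW) b ^ n

lemma IsGenericallyInseparable.exists_isPowerMap [IsFinite f] (hY : IsNormalScheme Y)
    (h : IsGenericallyInseparable f) (p : ℕ) [ExpChar (X.residueField (genericPoint X)) p] :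
    ∃ n ψ, IsPowerMap f (p ^ n) ψ := by
  obtain ⟨n, hn⟩ := h.exists_forall_genericValue_mem f p
  have exists_on (W : Y.Opens) : ∃ ψ : Γ(X, f ⁻¹ᵁ W) →+* Γ(Y, W), ∀ (hW : genericPoint Y ∈ W) b,
      genericResidueMap f (genericGerm hW (ψ b)) =
        genericValue (genericPoint_mem_preimage f hW) b ^ p ^ n := by
    by_cases hW : genericPoint Y ∈ W
    · obtain ⟨ψ, hψ⟩ := exists_ringHom_eq_pow (p := p) ((genericResidueMap f).comp (genericGerm hW))
        ((genericResidueMap f).injective.comp (genericGerm_injective hW))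
        (genericValue (genericPoint_mem_preimage f hW)) n fun b ↦ by
          obtain ⟨k, hk⟩ := mem_powSubfield.1 (hn _ (genericPoint_mem_preimage f hW) b)
          rw [← map_pow] at hk
          obtain ⟨a, rfl⟩ := exists_genericGerm_eq_of_genericResidueMap_eq f hY hW (b ^ p ^ n) hk
          exact ⟨a, hk.trans (map_pow _ _ _)⟩
      exact ⟨ψ, fun _ ↦ hψ⟩
    · have := subsingleton_sections hW
      let zero : Γ(X, f ⁻¹ᵁ W) →+* Γ(Y, W) :=
        { (0 : Γ(X, f ⁻¹ᵁ W) →+ Γ(Y, W)) with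
          map_one' := Subsingleton.elim _ _
          map_mul' := fun _ _ ↦ Subsingleton.elim _ _ }
      exact ⟨zero, fun h ↦ (hW h).elim⟩
  choose ψ hψ using exists_on
  exact ⟨n, ψ, hψ⟩

namespace IsPowerMap

variable {f} {n : ℕ} {ψ : ∀ W : Y.Opens, Γ(X, f ⁻¹ᵁ W) →+* Γ(Y, W)} (hψ : IsPowerMap f n ψ)

include hψ

lemma naturality {U V : Y.Opens} (hVU : V ≤ U) (b : Γ(X, f ⁻¹ᵁ U)) :
    resFun hVU (ψ U b) = ψ V (resFun (f.preimage_mono hVU) b) := by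
  by_cases hV : genericPoint Y ∈ V
  · apply genericGerm_injective hV
    apply (genericResidueMap f).injective
    rw [genericGerm_resFun, hψ, hψ, genericValue_resFun]
  · have := subsingleton_sections hV
    exact Subsingleton.elim _ _

lemma app (W : Y.Opens) (a : Γ(Y, W)) : ψ W (f.app W a) = a ^ n := by
  by_cases hW : genericPoint Y ∈ W
  · apply genericGerm_injective hW
    apply (genericResidueMap f).injective
    rw [hψ, map_pow, map_pow, genericResidueMap_genericGerm]
  · have := subsingleton_sections hW
    exact Subsingleton.elim _ _

lemma preimage_basicOpen (hn : 0 < n) (W : Y.Opens) (b : Γ(X, f ⁻¹ᵁ W)) :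
    f ⁻¹ᵁ Y.basicOpen (ψ W b) = X.basicOpen b := by
  by_cases hW : genericPoint Y ∈ W
  · rw [Scheme.preimage_basicOpen, ← X.basicOpen_pow b hn]
    apply basicOpen_eq_of_genericValue_eq (genericPoint_mem_preimage f hW)
    rw [← genericResidueMap_genericGerm f hW, hψ, map_pow]
  · obtain rfl := eq_bot_of_genericPoint_notMem hW
    exact (le_bot_iff.1 (f.preimage_mono (Y.basicOpen_le _))).trans
      (le_bot_iff.1 (X.basicOpen_le b)).symm

lemma isInducing (hn : 0 < n) [IsAffineHom f] : Topology.IsInducing f := by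
  refine ⟨le_antisymm f.continuous.le_induced fun V hV ↦ ?_⟩
  let V : X.Opens := ⟨V, hV⟩
  refine isOpen_induced_iff.2 ⟨⋃₀ {O | IsOpen O ∧ f ⁻¹' O ⊆ V}, isOpen_sUnion fun O hO ↦ hO.1,
    subset_antisymm ?_ fun x hx ↦ ?_⟩
  · rintro x ⟨O, hO, hx⟩
    exact hO.2 hx
  · obtain ⟨_, ⟨U, hU, rfl⟩, hxU, -⟩ := Y.isBasis_affineOpens.exists_subset_of_mem_open
      (Set.mem_univ (f x)) isOpen_univ
    obtain ⟨s, hsV, hxs⟩ := (hU.preimage f).exists_basicOpen_le (V := V) ⟨x, hx⟩ hxU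
    rw [← hψ.preimage_basicOpen hn] at hsV hxs
    exact ⟨_, ⟨(Y.basicOpen _).isOpen, hsV⟩, hxs⟩

lemma isHomeomorph (hn : 0 < n) [IsFinite f] : IsHomeomorph f := by
  have surjective : Function.Surjective f := by
    rw [← Set.range_eq_univ, ← f.isClosedMap.isClosed_range.closure_eq, f.denseRange.closure_range]
  have inducing := hψ.isInducing hn
  exact ((Equiv.ofBijective f ⟨inducing.injective, surjective⟩).toHomeomorphOfIsInducing
    inducing).isHomeomorph

end IsPowerMap

end GenericPower

/-- The morphism of schemes from `Y` to `X` whose underlying map is the inverse `σ` of the one of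
`f : X ⟶ Y`, and whose action on functions is given by `ψ`. -/
def inverseMk (f : X ⟶ Y) (σ : Y ≃ₜ X) (hσ : ∀ x, σ (f x) = x)
    (ψ : ∀ W : Y.Opens, Γ(X, f ⁻¹ᵁ W) →+* Γ(Y, W))
    (hψ : ∀ {U V : Y.Opens} (hVU : V ≤ U) (b : Γ(X, f ⁻¹ᵁ U)),
      resFun hVU (ψ U b) = ψ V (resFun (f.preimage_mono hVU) b))
    (preimage_basicOpen : ∀ (W : Y.Opens) (b : Γ(X, f ⁻¹ᵁ W)),
      f ⁻¹ᵁ Y.basicOpen (ψ W b) = X.basicOpen b) : Y ⟶ X where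
  base := TopCat.ofHom ⟨σ, σ.continuous⟩
  c :=
    { app := fun V ↦ CommRingCat.ofHom ((ψ ⟨σ ⁻¹' V.unop, V.unop.isOpen.preimage σ.continuous⟩).comp
        (resFun (fun x (hx : σ (f x) ∈ V.unop) ↦ hσ x ▸ hx)))
      naturality := fun U V i ↦ by
        ext b
        refine (congrArg (ψ _) ?_).trans (hψ (fun x hx ↦ i.unop.le hx) _).symm
        exact (resFun_resFun _ _ _).trans (resFun_resFun _ _ _).symm }
  prop y := by
    refine ⟨fun a ha ↦ ?_⟩
    obtain ⟨V, hV, s, rfl⟩ := X.presheaf.exists_germ_eq a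
    rw [PresheafedSpace.stalkMap_germ_apply] at ha
    let W : Y.Opens := ⟨σ ⁻¹' V, V.isOpen.preimage σ.continuous⟩
    have hW : f ⁻¹ᵁ W ≤ V := fun x (hx : σ (f x) ∈ V) ↦ hσ x ▸ hx
    have hy : y ∈ Y.basicOpen (ψ W (resFun hW s)) := (Y.mem_basicOpen _ y hV).2 ha
    have hσy : σ y ∈ f ⁻¹ᵁ Y.basicOpen (ψ W (resFun hW s)) := by
      change f (σ y) ∈ Y.basicOpen (ψ W (resFun hW s))
      rwa [σ.injective (hσ (σ y))]
    rw [preimage_basicOpen, resFun, Scheme.basicOpen_res] at hσy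
    exact (X.mem_basicOpen s _ hV).1 hσy.2

section IteratedFrobenius

variable (p : ℕ) [Fact p.Prime] (hp : (p : Γ(X, ⊤)) = 0)

lemma iteratedFrobenius_apply (n : ℕ) (x : X) : iteratedFrobenius p X hp n x = x := by
  induction n with
  | zero => rfl
  | succ _ ih => exact ih

lemma iteratedFrobenius_preimage (n : ℕ) (W : X.Opens) : iteratedFrobenius p X hp n ⁻¹ᵁ W = W :=
  Opens.ext (Set.ext fun x ↦ iff_of_eq (congrArg (· ∈ W) (iteratedFrobenius_apply p hp n x)))

lemma iteratedFrobenius_app (n : ℕ) (W : X.Opens) (a : Γ(X, W)) :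
    (iteratedFrobenius p X hp n).app W a =
      resFun (iteratedFrobenius_preimage p hp n W).le (a ^ p ^ n) := by
  induction n generalizing W with
  | zero => exact ((resFun_self _).trans (pow_one a)).symm
  | succ n ih =>
    refine (ih (absoluteFrobenius p X hp ⁻¹ᵁ W) (a ^ p)).trans (congrArg (resFun _) ?_)
    exact (pow_mul a p (p ^ n)).symm.trans (pow_succ' p n ▸ rfl)

lemma eq_iteratedFrobenius (n : ℕ) (g : X ⟶ X) (hg : ∀ x, g x = x)
    (happ : ∀ W (a : Γ(X, W)), g.app W a =
      resFun (fun x (hx : g x ∈ W) ↦ hg x ▸ hx) (a ^ p ^ n)) :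
    g = iteratedFrobenius p X hp n := by
  refine Scheme.Hom.ext ?_ fun W ↦ ?_
  · ext x
    exact (hg x).trans (iteratedFrobenius_apply p hp n x).symm
  · ext a
    rw [iteratedFrobenius_app]
    exact (congrArg (resFun _) (happ W a)).trans (resFun_resFun _ _ _)

lemma iteratedFrobenius_add (m n : ℕ) :
    iteratedFrobenius p X hp (m + n) = iteratedFrobenius p X hp m ≫ iteratedFrobenius p X hp n := by
  induction n with
  | zero => exact (Category.comp_id _).symm
  | succ n ih =>
    change iteratedFrobenius p X hp (m + n) ≫ _ = _ ≫ _ ≫ _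
    rw [ih, Category.assoc]

lemma iteratedFrobenius_one : iteratedFrobenius p X hp 1 = absoluteFrobenius p X hp :=
  Category.id_comp _

lemma iteratedFrobenius_succ' (n : ℕ) :
    iteratedFrobenius p X hp (n + 1) = absoluteFrobenius p X hp ≫ iteratedFrobenius p X hp n := by
  rw [add_comm, iteratedFrobenius_add, iteratedFrobenius_one]

/-- The identification of iterated Frobenius pull-backs. -/
def pullbackFrobeniusIso (M : X.Modules) (m n : ℕ) :
    (Scheme.Modules.pullback (absoluteFrobenius p X hp)).obj
      ((Scheme.Modules.pullback (iteratedFrobenius p X hp m)).obj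
        ((Scheme.Modules.pullback (iteratedFrobenius p X hp n)).obj M)) ≅
      (Scheme.Modules.pullback (iteratedFrobenius p X hp (m + 1 + n))).obj M :=
  (Scheme.Modules.pullbackComp _ _).app _ ≪≫ (Scheme.Modules.pullbackComp _ _).app M ≪≫
    (Scheme.Modules.pullbackCongr (by rw [iteratedFrobenius_add, iteratedFrobenius_succ'])).app M

end IteratedFrobenius

theorem IsGenericallyInseparable.exists_comp_eq_iteratedFrobenius [IsIntegral Y]
    [IrreducibleSpace X] (p : ℕ) [Fact p.Prime] (hp : (p : Γ(Y, ⊤)) = 0) (hY : IsNormalScheme Y)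
    (f : X ⟶ Y) [IsFinite f] (h : IsGenericallyInseparable f) :
    ∃ (n : ℕ) (g : Y ⟶ X), g ≫ f = iteratedFrobenius p Y hp n := by
  have := h.isDominant
  have : CharP (X.residueField (genericPoint X)) p :=
    charP_of_ringHom p ((genericResidueMap f).comp (genericGerm (W := ⊤) trivial)) hp
  have : ExpChar (X.residueField (genericPoint X)) p := .prime Fact.out
  obtain ⟨n, ψ, hψ⟩ := h.exists_isPowerMap f hY p
  have pow_pos : 0 < p ^ n := pow_pos (Fact.out : p.Prime).pos n
  let e := (hψ.isHomeomorph pow_pos).homeomorph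
  let g : Y ⟶ X := inverseMk f e.symm e.symm_apply_apply ψ hψ.naturality
    (hψ.preimage_basicOpen pow_pos)
  refine ⟨n, g, eq_iteratedFrobenius p hp n _ e.apply_symm_apply fun W a ↦ ?_⟩
  rw [← hψ.app W a]
  exact (hψ.naturality _ _).symm

lemma subsingleton_sections_of_iso {M N : X.Modules} (e : M ≅ N) (U : X.Opens)
    [Subsingleton Γ(N, U)] : Subsingleton Γ(M, U) := by
  refine ⟨fun a b ↦ ?_⟩
  have inv_hom (c : Γ(M, U)) : e.inv.app U (e.hom.app U c) = c :=
    congrArg (fun k : M ⟶ M ↦ k.app U c) e.hom_inv_id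
  rw [← inv_hom a, ← inv_hom b, Subsingleton.elim (e.hom.app U a) (e.hom.app U b)]

/-! ### Descent along iterates of Frobenius -/

lemma SplitsAfterPullback.of_iteratedFrobenius (p : ℕ) [Fact p.Prime] [IsIntegral X]
    (hp : (p : Γ(X, ⊤)) = 0) (hX : IsNormalScheme X) {M : X.Modules} (hM : IsLocallyFree M)
    {E : AbSheaf X} {i : toAbSheaf M ⟶ E} {q : E ⟶ constantZ X} {hz : i ≫ q = 0}
    (hS : (ShortComplex.mk i q hz).ShortExact)
    (h₀ : ∀ k, Subsingleton Γ(tensor ((Scheme.Modules.pullback (absoluteFrobenius p X hp)).obj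
      ((Scheme.Modules.pullback (iteratedFrobenius p X hp k)).obj M))
        (relativeDifferentials (absoluteFrobenius p X hp)), ⊤))
    (n : ℕ) (h : SplitsAfterPullback (iteratedFrobenius p X hp n) i) :
    SplitsAfterPullback (𝟙 X) i := by
  induction n with
  | zero => exact h
  | succ n ih =>
    rw [iteratedFrobenius_succ'] at h
    exact ih (h.of_frobenius_comp p hp hX _ (hM.pullback _) hS (h₀ n))

end FrobeniusPullback

end

theorem corollary2p4_general (p : ℕ) [Fact p.Prime] (S : Scheme.{u}) [IsIntegral S]
    (hp : (p : Γ(S, ⊤)) = 0) (hS : IsNormalScheme S) (M : S.Modules) (hM : IsLocallyFree M) (n₀ : ℕ)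
    (hn₀ : ∀ n : ℕ, n₀ < n → Subsingleton
      Γ(tensor ((Scheme.Modules.pullback (iteratedFrobenius p S hp n)).obj M)
        (relativeDifferentials (absoluteFrobenius p S hp)), ⊤))
    (S' : Scheme.{u}) [IrreducibleSpace S'] (φ : S' ⟶ S) [IsFinite φ]
    (hφ : IsGenericallyInseparable φ) :
    Function.Injective (cohomologyPullback φ
      ((Scheme.Modules.pullback (iteratedFrobenius p S hp n₀)).obj M) 1) := by
  rw [injective_iff_map_eq_zero]
  intro c hc
  obtain ⟨E, i, q, hz, hE, rfl⟩ := exists_shortExact_extClass_eq c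
  obtain ⟨N, g, hg⟩ := hφ.exists_comp_eq_iteratedFrobenius p hp hS φ
  have splits_iterate : SplitsAfterPullback (iteratedFrobenius p S hp N) i :=
    hg ▸ (splitsAfterPullback_of_cohomologyPullback_eq_zero φ _ i q hz hE hc).comp g
  have splits : SplitsAfterPullback (𝟙 S) i := by
    refine .of_iteratedFrobenius p hp hS (hM.pullback _) hE (fun k ↦ ?_) N splits_iterate
    have := hn₀ (k + 1 + n₀) (by lia)
    exact subsingleton_sections_of_iso (tensorIso (pullbackFrobeniusIso p hp M k n₀) _) ⊤
  obtain ⟨r, hr⟩ := splits.exists_retraction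
  exact extClass_eq_zero_of_retraction hE r hr

theorem corollary2p4 (p : ℕ) [Fact p.Prime] (k₀ : Type u) [Field k₀] [CharP k₀ p]
    (S : Scheme.{u}) [IsIntegral S] (π : S ⟶ Spec (.of k₀)) (hπ : IsProjectiveOver π)
    (hS : IsNormalScheme S) (V : S.Modules) (hV : IsAmpleBundle V) (n₀ : ℕ)
    (hn₀ : ∀ n : ℕ, n₀ < n → Subsingleton
      Γ(tensor
        ((Scheme.Modules.pullback
          (iteratedFrobenius p S (natCast_eq_zero_of_hom p π) n)).obj (dual V))
        (relativeDifferentials (absoluteFrobenius p S (natCast_eq_zero_of_hom p π))), ⊤))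
    (S' : Scheme.{u}) [IrreducibleSpace S'] (φ : S' ⟶ S) [IsFinite φ]
    (hφ : IsGenericallyInseparable φ) :
    Function.Injective
      (cohomologyPullback φ
        ((Scheme.Modules.pullback
          (iteratedFrobenius p S (natCast_eq_zero_of_hom p π) n₀)).obj (dual V)) 1) :=
  corollary2p4_general p S _ hS _ hV.isVectorBundle.isLocallyFree.dual n₀ hn₀ S' φ hφ
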